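/- **Setting.** Consider the projectable Hořava–Lifshitz theory with extra $U(1)$ symmetry (gauge $\varphi=0$), with $\lambda=1$, $\Lambda_g=0$, Newton constant $G>0$, $\zeta^2=1/(16\pi G)$, cosmological constant $\Lambda>0$ and arbitrary real couplings $g_2,\dots,g_8$, whose potential is $$\mathcal L_V=2\Lambda-R+\zeta^{-2}(g_2R^2+g_3R_{ij}R^{ij})+\zeta^{-4}\big(g_4R^3+g_5RR_{ij}R^{ij}+g_6R^i_jR^j_kR^k_i+g_7R\nabla^2R+g_8\nabla_iR_{jk}\nabla^iR^{jk}\big).$$ Spherically symmetric fields are given by functions $\mu,\nu$ of $(t,r)$, with lapse $1$, shift $N^r=e^{\mu-\nu}$ and spatial metric $g=e^{2\nu}dr^2+r^2d\Omega^2$, the gauge field $A$, and the matter variables $\rho_H$ (energy density), $v$ (heat flow), $p_r,p_\theta$ (pressures), $J_A,J_\varphi$. Put $F^{ij}=g^{-1/2}\,\delta(-g^{1/2}\mathcal L_V)/\delta g_{ij}$, and write $'=\partial_r$, $\dot{}=\partial_t$. The field equations and conservation laws are, with $\mathcal L_K=\frac4r\dot\nu e^{\mu-\nu}-\frac2{r^2}e^{2(\mu-\nu)}(2r\mu'+1)$,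 $\mathcal L_A=\frac{2A}{r^2}[e^{-2\nu}(1-2r\nu')-1]$, $F^A_{rr}=\frac2r(A'+A\nu')$, $F^A_{\theta\theta}=e^{-2\nu}[r^2(A''-\nu'A')+r(A'+A\nu')-A(1-e^{2\nu})]$: 1. $\int_0^\infty(\mathcal L_K+\mathcal L_V+4\pi G\rho_H)e^\nu r^2\,dr=0$ at every time $t$; 2. $2r(\nu'e^{\mu-\nu}-\dot\nu)=-8\pi Gr^2e^{\nu-\mu}v$; 3. $(1-e^{2\nu})(e^{\mu+\nu}\mu'-e^{2\nu}\dot\nu)-2\nu'e^{\mu+\nu}=8\pi Gr^2e^{4\nu}J_\varphi$; 4. $2r\nu'-(1-e^{2\nu})=4\pi Gr^2e^{2\nu}J_A$; 5. $\big[2(\mu'+\nu')+\frac1r\big]e^{2\mu}-2e^{\nu+\mu}(\dot\mu+\dot\nu)+\frac12re^{2\nu}\mathcal L_A=-r\big(F_{rr}+F^A_{rr}+8\pi Ge^{2\nu}p_r\big)$; 6. $\big[r(\mu''-\mu'\nu')+2\mu'-\nu'+2r\mu'^2\big]e^{2\mu}+\frac12re^{2\nu}\mathcal L_A+(\ddot\nu+\dot\nu^2)re^{2\nu}-\big[\dot\mu+r\mu'(\dot\nu+\dot\mu)+r(\dot\nu'+\dot\mu')\big]e^{\nu+\mu}=-\frac{e^{2\nu}}r\big(F_{\theta\theta}+F^A_{\theta\theta}+8\pi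 Gr^2p_\theta\big)$; 7. $\int_0^\infty e^\nu r^2\big[\dot\rho_H+(\rho_H+4p_r)\dot\nu+4(\dot v-v\dot\mu)-2A(\dot J_A+\dot\nu J_A)\big]dr=0$ at every time $t$; 8. $v\mu'-(v'-p_r')-\frac2r(v-p_r+p_\theta)-\frac12J_AA'-e^{\nu-\mu}[\dot v+v(2\dot\nu-\dot\mu)]=0$. Given a moving sphere $\Sigma:\ r=\mathcal R(t)$ with interior $M^-=\{0<r<\mathcal R(t)\}$ and exterior $M^+=\{r>\mathcal R(t)\}$, the fields may jump across $\Sigma$ and the matter variables and $A$ may contain terms $f\,\delta^{(n)}(r-\mathcal R(t))$. A *solution* means: $\mathcal R>0$ is $C^5$; $\mu,\nu$ are $C^5$ in $M^\pm$ up to $\Sigma$; across $\Sigma$, $\mu$ and $J_A$ are continuous and $\nu$ is $C^2$ in $r$; the normal of $\Sigma$ is spacelike, i.e. $(e^\mu+e^\nu\dot{\mathcal R})^2<1$ on $\Sigma$; and 1–8 hold in the sense of distributions, that is, 2–6 and 8 hold pointwise in $M^\pm$, the terms supported on $\Sigma$ in them vanish as distributions, and the integrals in 1 and 7 (over $M^\pm$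 plus the contribution of the terms on $\Sigma$) vanish. The conditions on $\Sigma$ are the junction conditions. **Proposition.** Let $t_0,A_0,\rho_H^{(0)}\in\mathbb R$ and $\mathcal R_0>0$. For $t<t_0$ put $$H(t)=-\sqrt{\tfrac\Lambda3}\tanh\Big(\tfrac{\sqrt{3\Lambda}}2(t_0-t)\Big),\qquad \mathcal R(t)=\mathcal R_0\cosh^{2/3}\Big(\tfrac{\sqrt{3\Lambda}}2(t_0-t)\Big),$$ $$\nu=0,\quad \mu^-=\ln(-H(t)r),\quad \mu^+=\tfrac12\ln\Big(\tfrac{\Lambda r^2}3-\tfrac{\mathcal R_0^3\Lambda}{3r}\Big),\quad A=A_0,\quad p_r=p_\theta=v=J_A=J_\varphi=0,$$ and let $\rho_H$ be $0$ in $M^+$, the constant $\rho_H^{(0)}$ in $M^-$, plus the shell $\rho_H^{Im(0)}\delta(r-\mathcal R(t))$, where $$\rho_H^{Im(0)}(t)=-\mathcal R_0\,\frac{\Lambda+\pi G\big[1+\cosh(\sqrt{3\Lambda}(t_0-t))\big]\rho_H^{(0)}}{6\pi G\cosh^{4/3}\big(\tfrac{\sqrt{3\Lambda}}2(t_0-t)\big)}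 .$$ Then this is a solution for $t<t_0$. Moreover, for $t<t_0$, $H<0$, $\dot{\mathcal R}=H\mathcal R$, $\mathcal R$ is strictly decreasing and $\mathcal R(t)>\mathcal R_0$; the argument of the logarithm in $\mu^+$ is positive for all $r>\mathcal R_0$; and the exterior metric $-dt^2+(dr+e^{\mu^+}dt)^2+r^2d\Omega^2$ on $r>\mathcal R_0$ is the Schwarzschild–de Sitter metric of negative mass $M_+=-\Lambda\mathcal R_0^3/6$: with $f(r)=1-\frac{2M_+}r-\frac{\Lambda r^2}3$, on every open interval of radii $r>\mathcal R_0$ where $f\neq0$ a substitution $t=\tau+\psi(r)$ turns it into $-f\,d\tau^2+f^{-1}dr^2+r^2d\Omega^2$. -/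

import Mathlib

/-!
Spherically symmetric Horava-Lifshitz gravity with the projectability condition and the extra `U(1)`
symmetry, in the gauge in which the Newtonian prepotential vanishes, with fields that may be
discontinuous across, or carry distributional layers on, a moving sphere `r = R t`.
-/

noncomputable section

namespace HoravaLifshitz

/-- A distribution `F⁺ H(Φ) + F⁻ (1 - H(Φ)) + ∑ₙ F⁽ⁿ⁾ δ⁽ⁿ⁾(Φ)` in the variables `(t, r)`, where
`Φ = r - R t` for some moving radius `R`. The functions `plus`, `minus` and `layer n` are given with
an extension to both sides of the sphere. -/
structure Layered where
  plus : ℝ → ℝ → ℝ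
  minus : ℝ → ℝ → ℝ
  layer : ℕ → ℝ → ℝ → ℝ

namespace Layered

/-- A function that is the same on the two sides. -/
def smooth (f : ℝ → ℝ → ℝ) : Layered := ⟨f, f, fun _ _ _ => 0⟩

/-- A function given by `f` outside and by `g` inside the sphere, without layers. -/
def piecewise (f g : ℝ → ℝ → ℝ) : Layered := ⟨f, g, fun _ _ _ => 0⟩

/-- The coefficient with which the function part multiplies a layer; this is the convention
`H(0) = 1 / 2`. If the function part is `C^n` across the sphere then so is its mean, with the same
derivatives of order at most `n` on the sphere as from either side, so that its product with
`δ⁽ⁿ⁾(Φ)` is the usual one. -/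
def mean (F : Layered) (t r : ℝ) : ℝ := (F.plus t r + F.minus t r) / 2

instance (n : ℕ) : OfNat Layered n := ⟨smooth fun _ _ => (n : ℝ)⟩

instance : Neg Layered := ⟨fun F => ⟨-F.plus, -F.minus, -F.layer⟩⟩

instance : Add Layered := ⟨fun F G => ⟨F.plus + G.plus, F.minus + G.minus, F.layer + G.layer⟩⟩

instance : Sub Layered := ⟨fun F G => ⟨F.plus - G.plus, F.minus - G.minus, F.layer - G.layer⟩⟩

instance : SMul ℝ Layered := ⟨fun a F => ⟨a • F.plus, a • F.minus, a • F.layer⟩⟩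

/-- Product of a function and a layered distribution (products of two layers do not occur in the
field equations under the regularity conditions `Regular` below). -/
instance : Mul Layered := ⟨fun F G =>
  ⟨F.plus * G.plus, F.minus * G.minus,
    fun n t r => F.mean t r * G.layer n t r + F.layer n t r * G.mean t r⟩⟩

instance : Pow Layered ℕ := ⟨fun F k =>
  ⟨F.plus ^ k, F.minus ^ k, fun n t r => k * F.mean t r ^ (k - 1) * F.layer n t r⟩⟩

/-- The exponential of a piecewise function. -/
def exp (F : Layered) : Layered :=
  piecewise (fun t r => Real.exp (F.plus t r)) (fun t r => Real.exp (F.minus t r))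

/-- The coordinate `r`. -/
def radius : Layered := smooth fun _ r => r

/-- The function `1 / r`. -/
def invRadius : Layered := smooth fun _ r => r⁻¹

/-- The distributional derivative with respect to `r`, from `∂H(Φ)/∂r = δ(Φ)` and
`∂δ⁽ⁿ⁾(Φ)/∂r = δ⁽ⁿ⁺¹⁾(Φ)`. -/
def dr (F : Layered) : Layered where
  plus t r := deriv (fun x => F.plus t x) r
  minus t r := deriv (fun x => F.minus t x) r
  layer
    | 0, t, r => deriv (fun x => F.layer 0 t x) r + (F.plus t r - F.minus t r)
    | n + 1, t, r => deriv (fun x => F.layer (n + 1) t x) r + F.layer n t r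

/-- The distributional derivative with respect to `t`, from `∂H(Φ)/∂t = -R' δ(Φ)` and
`∂δ⁽ⁿ⁾(Φ)/∂t = -R' δ⁽ⁿ⁺¹⁾(Φ)`. -/
def dt (R : ℝ → ℝ) (F : Layered) : Layered where
  plus t r := deriv (fun x => F.plus x r) t
  minus t r := deriv (fun x => F.minus x r) t
  layer
    | 0, t, r => deriv (fun x => F.layer 0 x r) t - deriv R t * (F.plus t r - F.minus t r)
    | n + 1, t, r => deriv (fun x => F.layer (n + 1) x r) t - deriv R t * F.layer n t r

/-- `F = 0` as a distribution over the time set `I`: the function parts vanish in the exterior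
`r > R t` and in the interior `0 < r < R t`, and the finitely many layers sum up to the zero
distribution, where `δ⁽ⁿ⁾(r - R t)` pairs with a test function `ψ` to `(-1)ⁿ ψ⁽ⁿ⁾(R t)`.
(Pairing with respect to `dt dr` on every time slice; passing to the metric volume only rescales
the test functions.) -/
def Vanishes (I : Set ℝ) (R : ℝ → ℝ) (F : Layered) : Prop :=
  (∀ t ∈ I, ∀ r, R t < r → F.plus t r = 0) ∧
  (∀ t ∈ I, ∀ r, 0 < r → r < R t → F.minus t r = 0) ∧
  ∃ N : ℕ, (∀ n, N ≤ n → ∀ t ∈ I, ∀ r, F.layer n t r = 0) ∧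
    ∀ t ∈ I, ∀ ψ : ℝ → ℝ, ContDiff ℝ ((⊤ : ℕ∞) : WithTop ℕ∞) ψ → HasCompactSupport ψ →
      tsupport ψ ⊆ Set.Ioi 0 →
        ∑ n ∈ Finset.range N, (-1 : ℝ) ^ n * iteratedDeriv n (fun r => F.layer n t r * ψ r) (R t) = 0

/-- `∫₀^∞ F dr = 0` at every time of `I`, where both function parts are integrable and the layers
contribute `∫ f δ⁽ⁿ⁾(r - R t) dr = (-1)ⁿ ∂ⁿf/∂rⁿ` at `r = R t`. -/
def IntegralVanishes (I : Set ℝ) (R : ℝ → ℝ) (F : Layered) : Prop :=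
  ∃ N : ℕ, (∀ n, N ≤ n → ∀ t ∈ I, ∀ r, F.layer n t r = 0) ∧
    ∀ t ∈ I,
      MeasureTheory.IntegrableOn (fun r => F.minus t r) (Set.Ioo 0 (R t)) ∧
      MeasureTheory.IntegrableOn (fun r => F.plus t r) (Set.Ioi (R t)) ∧
      (∫ r in Set.Ioo 0 (R t), F.minus t r) + (∫ r in Set.Ioi (R t), F.plus t r) +
        ∑ n ∈ Finset.range N, (-1 : ℝ) ^ n * iteratedDeriv n (fun r => F.layer n t r) (R t) = 0

/-- No layer is present. -/
def NoLayer (F : Layered) : Prop := ∀ n t r, F.layer n t r = 0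

/-- The function parts are `C^5` in the exterior and in the interior, up to the sphere. -/
def PiecewiseC5 (I : Set ℝ) (R : ℝ → ℝ) (F : Layered) : Prop :=
  (∃ U : Set (ℝ × ℝ), IsOpen U ∧ {p : ℝ × ℝ | p.1 ∈ I ∧ R p.1 ≤ p.2} ⊆ U ∧
    ContDiffOn ℝ 5 (fun p : ℝ × ℝ => F.plus p.1 p.2) U) ∧
  (∃ U : Set (ℝ × ℝ), IsOpen U ∧ {p : ℝ × ℝ | p.1 ∈ I ∧ 0 < p.2 ∧ p.2 ≤ R p.1} ⊆ U ∧
    ContDiffOn ℝ 5 (fun p : ℝ × ℝ => F.minus p.1 p.2) U)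

/-- The derivatives with respect to `r` of order at most `k` agree on the two sides of the sphere. -/
def MatchesTo (k : ℕ) (I : Set ℝ) (R : ℝ → ℝ) (F : Layered) : Prop :=
  ∀ j ≤ k, ∀ t ∈ I, iteratedDeriv j (F.plus t) (R t) = iteratedDeriv j (F.minus t) (R t)

end Layered

open Layered

/-- Coupling constants: Newton's constant `G`, the cosmological constant `Λ = ζ² g₀ / 2`, the constant
`Λg` coupled to the gauge field, the kinetic coupling `lam`, and `g₂, …, g₈`. The remaining ones are
fixed by the relativistic infrared limit: `g₁ = -1` and `ζ² = 1 / (16 π G)`. -/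
structure Couplings where
  G : ℝ
  Λ : ℝ
  Λg : ℝ
  lam : ℝ
  g₂ : ℝ
  g₃ : ℝ
  g₄ : ℝ
  g₅ : ℝ
  g₆ : ℝ
  g₇ : ℝ
  g₈ : ℝ

/-- `1 / ζ²`. -/
def Couplings.invZetaSq (c : Couplings) : ℝ := 16 * Real.pi * c.G

/-- Spherically symmetric fields. The ADM variables are lapse `1`, shift `N^r = e^(μ-ν)` and spatial
metric `e^(2ν) dr² + r² dΩ²`; `A` is the gauge field; the matter is described by the energy density
`ρH = -2 J^t`, the heat flow `v` (with `J^r = e^(-μ-ν) v`), the pressures `pr`, `pθ`, and the sources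
`JA`, `Jφ` of `A` and of the Newtonian prepotential. -/
structure Fields where
  μ : Layered
  ν : Layered
  A : Layered
  ρH : Layered
  v : Layered
  pr : Layered
  pθ : Layered
  JA : Layered
  Jφ : Layered

/-! ### The potential and its variation -/

section Potential

variable (ν : Layered)

/-- The Ricci component `R^r_r`. -/
def ricciR : Layered := 2 * invRadius * exp (-2 * ν) * dr ν

/-- The Ricci component `R^θ_θ = R^φ_φ`. -/
def ricciΘ : Layered := invRadius ^ 2 * exp (-2 * ν) * (radius * dr ν - (1 - exp (2 * ν)))

/-- The scalar curvature of the spatial metric. -/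
def scalarR : Layered := ricciR ν + 2 * ricciΘ ν

/-- `R_ij R^ij`. -/
def ricciSq : Layered := ricciR ν ^ 2 + 2 * ricciΘ ν ^ 2

/-- `R^i_j R^j_k R^k_i`. -/
def ricciCube : Layered := ricciR ν ^ 3 + 2 * ricciΘ ν ^ 3

/-- The Laplacian of the spatial metric on functions of `r`. -/
def laplacian (f : Layered) : Layered :=
  exp (-ν) * invRadius ^ 2 * dr (radius ^ 2 * exp (-ν) * dr f)

/-- `(∇_i R_jk) (∇^i R^jk)`. -/
def gradRicciSq : Layered :=
  exp (-2 * ν) * (dr (ricciR ν) ^ 2 + 2 * dr (ricciΘ ν) ^ 2 +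
    4 * invRadius ^ 2 * (ricciR ν - ricciΘ ν) ^ 2)

/-- The potential `L_V`. -/
def potential (c : Couplings) : Layered :=
  (2 * c.Λ) • (1 : Layered) - scalarR ν
    + c.invZetaSq • (c.g₂ • scalarR ν ^ 2 + c.g₃ • ricciSq ν)
    + c.invZetaSq ^ 2 • (c.g₄ • scalarR ν ^ 3 + c.g₅ • (scalarR ν * ricciSq ν) + c.g₆ • ricciCube ν
      + c.g₇ • (scalarR ν * laplacian ν (scalarR ν)) + c.g₈ • gradRicciSq ν)

/- The components `rr` and `θθ` of the tensors `(F_s)_ij`: for each `s`, `(F_s)^ij` is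
`g^(-1/2) δ(-g^(1/2) L) / δ g_ij` for the `s`-th of the scalars
`1, R, R², R_ij R^ij, R³, R R_ij R^ij, R^i_j R^j_k R^k_i, R ∇²R, ∇_i R_jk ∇^i R^jk`. -/

def F0rr : Layered :=
  let E : ℝ → Layered := fun k => exp (k • ν);
  (-1 / 2 : ℝ) • E 2

def F0θθ : Layered :=
  let r := radius;
  (-1 / 2 : ℝ) • (r ^ 2)

def F1rr : Layered :=
  let E : ℝ → Layered := fun k => exp (k • ν);
  let ρ := invRadius;
  (1 - E 2) * ρ ^ 2

def F1θθ : Layered :=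
  let E : ℝ → Layered := fun k => exp (k • ν);
  let r := radius;
  let n1 := dr ν;
  -(E (-2) * r * n1)

def F2rr : Layered :=
  let E : ℝ → Layered := fun k => exp (k • ν);
  let r := radius;
  let ρ := invRadius;
  let n1 := dr ν;
  let n2 := dr n1;
  -(2 * E (-2) * ρ ^ 4) * (6 * E 2 + E 4 - 8 * r ^ 2 * n2 + 12 * r ^ 2 * n1 ^ 2 - 7)

def F2θθ : Layered :=
  let E : ℝ → Layered := fun k => exp (k • ν);
  let r := radius;
  let ρ := invRadius;
  let n1 := dr ν;
  let n2 := dr n1;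
  let n3 := dr n2;
  2 * E (-4) * ρ ^ 2 * (6 * E 2 + E 4 + 4 * n3 * r ^ 3 + 24 * r ^ 3 * n1 ^ 3 - 2 * r * n1 *
    (-3 * E 2 + 14 * r ^ 2 * n2 + 7) - 7)

def F3rr : Layered :=
  let E : ℝ → Layered := fun k => exp (k • ν);
  let r := radius;
  let ρ := invRadius;
  let n1 := dr ν;
  let n2 := dr n1;
  -(E (-2) * ρ ^ 4) * (4 * E 2 + E 4 - 6 * r ^ 2 * n2 + 9 * r ^ 2 * n1 ^ 2 - 5)

def F3θθ : Layered :=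
  let E : ℝ → Layered := fun k => exp (k • ν);
  let r := radius;
  let ρ := invRadius;
  let n1 := dr ν;
  let n2 := dr n1;
  let n3 := dr n2;
  E (-4) * ρ ^ 2 * (4 * E 2 + E 4 + 3 * n3 * r ^ 3 + 18 * r ^ 3 * n1 ^ 3 - r * n1 * (-4 * E 2
    + 21 * r ^ 2 * n2 + 10) - 5)

def F4rr : Layered :=
  let E : ℝ → Layered := fun k => exp (k • ν);
  let r := radius;
  let ρ := invRadius;
  let n1 := dr ν;
  let n2 := dr n1;
  -(4 * E (-4) * ρ ^ 6) * (E 2 + 2 * r * n1 - 1) * (22 * E 2 + E 4 - 24 * r ^ 2 * n2 + 40 * r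
    ^ 2 * n1 ^ 2 - 2 * (E 2 - 1) * r * n1 - 23)

def F4θθ : Layered :=
  let E : ℝ → Layered := fun k => exp (k • ν);
  let r := radius;
  let ρ := invRadius;
  let n1 := dr ν;
  let n2 := dr n1;
  let n3 := dr n2;
  4 * E (-6) * ρ ^ 4 * (240 * r ^ 4 * n1 ^ 4 + 4 * (18 * E 2 - 17) * r ^ 3 * n1 ^ 3 - 12 * r ^
    2 * n1 ^ 2 * (-11 * E 2 + 22 * r ^ 2 * n2 + 15) + 3 * r * n1 * (-6 * E 2 + 7 * E 4 + 8 *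
    n3 * r ^ 3 - 28 * (E 2 - 1) * r ^ 2 * n2 - 1) + 2 * (12 * r ^ 4 * n2 ^ 2 - 24 * (E 2 - 1)
    * r ^ 2 * n2 + (E 2 - 1) * (22 * E 2 + E 4 + 6 * n3 * r ^ 3 - 23)))

def F5rr : Layered :=
  let E : ℝ → Layered := fun k => exp (k • ν);
  let r := radius;
  let ρ := invRadius;
  let n1 := dr ν;
  let n2 := dr n1;
  -(2 * E (-4) * ρ ^ 6) * (60 * r ^ 3 * n1 ^ 3 + (E 2 - 1) * (16 * E 2 + E 4 - 14 * r ^ 2 * n2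
    - 17) + (21 * E 2 - 17) * r ^ 2 * n1 ^ 2 - 4 * r * n1 * (-7 * E 2 + 9 * r ^ 2 * n2 + 7))

def F5θθ : Layered :=
  let E : ℝ → Layered := fun k => exp (k • ν);
  let r := radius;
  let ρ := invRadius;
  let n1 := dr ν;
  let n2 := dr n1;
  let n3 := dr n2;
  2 * E (-6) * ρ ^ 4 * (18 * r ^ 4 * n2 ^ 2 + 180 * r ^ 4 * n1 ^ 4 + (E 2 - 1) * (32 * E 2 + 2
    * E 4 + 7 * n3 * r ^ 3 - 34) + 21 * (2 * E 2 - 1) * r ^ 3 * n1 ^ 3 - 28 * (E 2 - 1) * r ^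
    2 * n2 - r ^ 2 * n1 ^ 2 * (-77 * E 2 + 198 * r ^ 2 * n2 + 101) + r * n1 * (3 * (-8 * E 2 +
    5 * E 4 + 6 * n3 * r ^ 3 + 3) - (49 * E 2 - 41) * r ^ 2 * n2))

def F6rr : Layered :=
  let E : ℝ → Layered := fun k => exp (k • ν);
  let r := radius;
  let ρ := invRadius;
  let n1 := dr ν;
  let n2 := dr n1;
  E (-4) * ρ ^ 6 * (-50 * r ^ 3 * n1 ^ 3 - (E 2 - 1) * (13 * E 2 + E 4 - 6 * r ^ 2 * n2 - 14)
    - 9 * E 2 * r ^ 2 * n1 ^ 2 + 6 * r * n1 * (-2 * E 2 + 5 * r ^ 2 * n2 + 2))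

def F6θθ : Layered :=
  let E : ℝ → Layered := fun k => exp (k • ν);
  let r := radius;
  let ρ := invRadius;
  let n1 := dr ν;
  let n2 := dr n1;
  let n3 := dr n2;
  E (-6) * ρ ^ 4 * (15 * r ^ 4 * n2 ^ 2 + 150 * r ^ 4 * n1 ^ 4 + (E 2 - 1) * (26 * E 2 + 2 * E
    4 + 3 * n3 * r ^ 3 - 28) + (18 * E 2 + 25) * r ^ 3 * n1 ^ 3 - 12 * (E 2 - 1) * r ^ 2 * n2
    - 3 * r ^ 2 * n1 ^ 2 * (-11 * E 2 + 55 * r ^ 2 * n2 + 12) + 3 * r * n1 * (-12 * E 2 + 4 *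
    E 4 + 5 * n3 * r ^ 3 - (7 * E 2 - 1) * r ^ 2 * n2 + 8))

def F7rr : Layered :=
  let E : ℝ → Layered := fun k => exp (k • ν);
  let r := radius;
  let ρ := invRadius;
  let n1 := dr ν;
  let n2 := dr n1;
  let n3 := dr n2;
  let n4 := dr n3;
  -(8 * E (-4) * ρ ^ 6 * (6 * E 2 + E 4 - 2 * n4 * r ^ 4 + 15 * r ^ 4 * n2 ^ 2 + 40 * r ^ 4 *
    n1 ^ 4 + 4 * r * n1 * (2 * E 2 + 5 * n3 * r ^ 3 - 6) - 2 * r ^ 2 * n1 ^ 2 * (-3 * E 2 + 41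
    * r ^ 2 * n2 + 15) - 4 * (E 2 - 3) * r ^ 2 * n2 - 7))

def F7θθ : Layered :=
  let E : ℝ → Layered := fun k => exp (k • ν);
  let r := radius;
  let ρ := invRadius;
  let n1 := dr ν;
  let n2 := dr n1;
  let n3 := dr n2;
  let n4 := dr n3;
  let n5 := dr n4;
  (8 * E (-6) * ρ ^ 4) * (12 * E 2 + 2 * E 4 + n5 * r ^ 5 + 120 * r ^ 5 * n1 ^ 5 + 2 * E 2 *
    n3 * r ^ 3 - 6 * n3 * r ^ 3 + r * n1 * (24 * E 2 + E 4 - 16 * n4 * r ^ 4 + 127 * r ^ 4 *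
    n2 ^ 2 - 2 * (7 * E 2 - 33) * r ^ 2 * n2 - 57) - r ^ 2 * n2 * (8 * E 2 + 25 * n3 * r ^ 3 -
    24) + r ^ 2 * n1 ^ 2 * (22 * E 2 + 101 * n3 * r ^ 3 - 102) - 2 * r ^ 3 * n1 ^ 3 * (-6 * E
    2 + 163 * r ^ 2 * n2 + 45) - 14)

def F8rr : Layered :=
  let E : ℝ → Layered := fun k => exp (k • ν);
  let r := radius;
  let ρ := invRadius;
  let n1 := dr ν;
  let n2 := dr n1;
  let n3 := dr n2;
  let n4 := dr n3;
  E (-4) * ρ ^ 6 * (6 * (2 * E 2 + E 4 - n4 * r ^ 4 - 3) + 45 * r ^ 4 * n2 ^ 2 + 120 * r ^ 4 *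
    n1 ^ 4 + 10 * r ^ 3 * n1 ^ 3 - 8 * (E 2 - 4) * r ^ 2 * n2 - r ^ 2 * n1 ^ 2 * (-12 * E 2 +
    246 * r ^ 2 * n2 + 77) + 2 * r * n1 * (8 * E 2 + 30 * n3 * r ^ 3 - 3 * r ^ 2 * n2 - 32))

def F8θθ : Layered :=
  let E : ℝ → Layered := fun k => exp (k • ν);
  let r := radius;
  let ρ := invRadius;
  let n1 := dr ν;
  let n2 := dr n1;
  let n3 := dr n2;
  let n4 := dr n3;
  let n5 := dr n4;
  E (-6) * ρ ^ 4 * (-24 * E 2 - 12 * E 4 - 3 * n5 * r ^ 5 - 360 * r ^ 5 * n1 ^ 5 - 3 * r ^ 4 *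
    n2 ^ 2 - 30 * r ^ 4 * n1 ^ 4 - 4 * E 2 * n3 * r ^ 3 + 16 * n3 * r ^ 3 + r ^ 2 * n2 * (16 *
    E 2 + 75 * n3 * r ^ 3 - 64) + 2 * r ^ 3 * n1 ^ 3 * (-12 * E 2 + 489 * r ^ 2 * n2 + 113) -
    r ^ 2 * n1 ^ 2 * (44 * E 2 + 303 * n3 * r ^ 3 - 33 * r ^ 2 * n2 - 269) - r * n1 * (381 * r
    ^ 4 * n2 ^ 2 - 2 * (14 * E 2 - 85) * r ^ 2 * n2 + 6 * (8 * E 2 + E 4 - 8 * n4 * r ^ 4 -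
    25) + 3 * n3 * r ^ 3) + 36)

/-- `F_rr`, the variation of the potential. -/
def Frr (c : Couplings) : Layered :=
  (2 * c.Λ) • F0rr ν - F1rr ν + c.invZetaSq • (c.g₂ • F2rr ν + c.g₃ • F3rr ν)
    + c.invZetaSq ^ 2 • (c.g₄ • F4rr ν + c.g₅ • F5rr ν + c.g₆ • F6rr ν + c.g₇ • F7rr ν + c.g₈ • F8rr ν)

/-- `F_θθ`, the variation of the potential. -/
def Fθθ (c : Couplings) : Layered :=
  (2 * c.Λ) • F0θθ - F1θθ ν + c.invZetaSq • (c.g₂ • F2θθ ν + c.g₃ • F3θθ ν)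
    + c.invZetaSq ^ 2 • (c.g₄ • F4θθ ν + c.g₅ • F5θθ ν + c.g₆ • F6θθ ν + c.g₇ • F7θθ ν + c.g₈ • F8θθ ν)

end Potential

/-! ### The field equations and conservation laws -/

section Equations

variable (c : Couplings) (R : ℝ → ℝ) (f : Fields)

/-- The kinetic term `L_K = K_ij K^ij - λ K²`. -/
def kinetic : Layered :=
  (1 - c.lam) • (dt R f.ν ^ 2 - 2 * dt R f.ν * dr f.μ * exp (f.μ - f.ν)
      + (dr f.μ ^ 2 + 2 * invRadius ^ 2) * exp (2 * (f.μ - f.ν)))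
    + c.lam • (4 * invRadius * dt R f.ν * exp (f.μ - f.ν)
      - 2 * invRadius ^ 2 * exp (2 * (f.μ - f.ν)) * (2 * radius * dr f.μ + 1))

/-- The gauge field term `L_A = A (2 Λg - R)`. -/
def gaugeTerm : Layered :=
  2 * f.A * invRadius ^ 2 *
    (exp (-2 * f.ν) * (1 - 2 * radius * dr f.ν) + c.Λg • radius ^ 2 - 1)

/-- `(F_A)_rr`. -/
def FArr : Layered := 2 * invRadius * (dr f.A + f.A * dr f.ν)

/-- `(F_A)_θθ`. -/
def FAθθ : Layered :=
  exp (-2 * f.ν) * (radius ^ 2 * (dr (dr f.A) - dr f.ν * dr f.A)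
    + radius * (dr f.A + f.A * dr f.ν) - f.A * (1 - exp (2 * f.ν)))

/-- The factor `e^(2ν) (Λg r² - 1) + 1`. -/
def gaugeFactor : Layered := exp (2 * f.ν) * (c.Λg • radius ^ 2 - 1) + 1

/-- Integrand of the Hamiltonian constraint (variation of the lapse `N(t)`). -/
def hamiltonianIntegrand : Layered :=
  (kinetic c R f + potential f.ν c + (4 * Real.pi * c.G) • f.ρH) * exp f.ν * radius ^ 2

/-- Momentum constraint (variation of the shift). -/
def momentumConstraint : Layered :=
  (1 - c.lam) • (exp (f.μ - f.ν) *
        (radius ^ 2 * (dr (dr f.μ) + dr f.μ ^ 2 - dr f.μ * dr f.ν) + 2 * (radius * dr f.μ - 1))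
      - radius ^ 2 * dt R (dr f.ν))
    + 2 * radius * (c.lam • (dr f.ν * exp (f.μ - f.ν)) - dt R f.ν)
    + (8 * Real.pi * c.G) • (radius ^ 2 * exp (f.ν - f.μ) * f.v)

/-- Equation from the variation of the Newtonian prepotential. -/
def prepotentialEquation : Layered :=
  let μ1 := dr f.μ;
  let μ2 := dr μ1;
  let μ3 := dr μ2;
  let ν1 := dr f.ν;
  let ν2 := dr ν1;
  gaugeFactor c f * (exp (f.μ + f.ν) * μ1 - exp (2 * f.ν) * dt R f.ν)
    - 2 * (ν1 - c.Λg • (radius * exp (2 * f.ν))) * exp (f.μ + f.ν)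
    + (1 - c.lam) •
      (exp (2 * f.ν) * (-(radius ^ 2 * dt R ν2) + radius ^ 2 * dt R ν1 * ν1 - 2 * radius * dt R ν1)
      + exp (f.μ + f.ν) * (radius ^ 2 * (μ3 + 3 * μ1 * μ2 - μ1 * ν2 - 3 * μ2 * ν1 + μ1 ^ 3
          - 3 * ν1 * μ1 ^ 2 + 2 * μ1 * ν1 ^ 2)
        + 2 * radius * (2 * μ2 - ν2 + 2 * (ν1 - μ1) ^ 2) + 2 * ν1))
    - (8 * Real.pi * c.G) • (radius ^ 2 * exp (4 * f.ν) * f.Jφ)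

/-- Equation from the variation of the gauge field. -/
def gaugeEquation : Layered :=
  2 * radius * dr f.ν - gaugeFactor c f
    - (4 * Real.pi * c.G) • (radius ^ 2 * exp (2 * f.ν) * f.JA)

/-- The `rr` dynamical equation. -/
def dynamicalRR : Layered :=
  let μ1 := dr f.μ;
  let ν1 := dr f.ν;
  (1 - c.lam) • (radius * (exp (f.ν + f.μ) * (dt R f.μ * μ1 + dt R μ1 - dt R ν1)
      - exp (2 * f.ν) * (dt R (dt R f.ν) + (1 / 2 : ℝ) • dt R f.ν ^ 2)
      + exp (2 * f.μ) * (dr μ1 + (1 / 2 : ℝ) • μ1 ^ 2 - μ1 * ν1)))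
    + (2 * (μ1 + c.lam • ν1) + (4 * c.lam - 3) • invRadius) * exp (2 * f.μ)
    - 2 * exp (f.ν + f.μ) * (c.lam • dt R f.μ + dt R f.ν)
    + (1 / 2 : ℝ) • (radius * exp (2 * f.ν) * gaugeTerm c f)
    + radius * (Frr f.ν c + FArr f + (8 * Real.pi * c.G) • (exp (2 * f.ν) * f.pr))

/-- The `θθ` dynamical equation. -/
def dynamicalΘΘ : Layered :=
  let μ1 := dr f.μ;
  let ν1 := dr f.ν;
  (c.lam • (radius * (dr μ1 - μ1 * ν1)) + (2 * c.lam - 1) • (2 * μ1 - ν1)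
      + ((3 * c.lam + 1) / 2) • (radius * μ1 ^ 2)) * exp (2 * f.μ)
    + (1 / 2 : ℝ) • (radius * exp (2 * f.ν) * gaugeTerm c f)
    + (c.lam • dt R (dt R f.ν) + ((c.lam + 1) / 2) • dt R f.ν ^ 2) * radius * exp (2 * f.ν)
    - ((2 * c.lam - 1) • dt R f.μ + radius * μ1 * (dt R f.ν + c.lam • dt R f.μ)
      + c.lam • (radius * (dt R ν1 + dt R μ1))) * exp (f.ν + f.μ)
    + exp (2 * f.ν) * invRadius *
      (Fθθ f.ν c + FAθθ f + (8 * Real.pi * c.G) • (radius ^ 2 * f.pθ))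

/-- Integrand of the energy conservation law. -/
def energyIntegrand : Layered :=
  exp f.ν * radius ^ 2 * (dt R f.ρH + (f.ρH + 4 * f.pr) * dt R f.ν
    + 4 * (dt R f.v - f.v * dt R f.μ) - 2 * f.A * (dt R f.JA + dt R f.ν * f.JA))

/-- Momentum conservation law. -/
def momentumConservation : Layered :=
  f.v * dr f.μ - (dr f.v - dr f.pr) - 2 * invRadius * (f.v - f.pr + f.pθ)
    - (1 / 2 : ℝ) • (f.JA * dr f.A)
    - exp (f.ν - f.μ) * (dt R f.v + f.v * (2 * dt R f.ν - dt R f.μ))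

/-- The regularity that makes the field equations with `λ = 1` meaningful as distributions: the
radius of the sphere is positive and `C^5`; `μ` and `ν` are `C^5` on either side up to the sphere;
`μ` is continuous and `ν` is `C^2` in `r` across it; `JA` is continuous across it; and the normal
of the sphere is spacelike. -/
structure Regular (I : Set ℝ) : Prop where
  radius_pos : ∀ t ∈ I, 0 < R t
  radius_C5 : ContDiffOn ℝ 5 R I
  noLayer_μ : f.μ.NoLayer
  noLayer_ν : f.ν.NoLayer
  noLayer_JA : f.JA.NoLayer
  piecewise_μ : f.μ.PiecewiseC5 I R
  piecewise_ν : f.ν.PiecewiseC5 I R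
  matches_μ : f.μ.MatchesTo 0 I R
  matches_ν : f.ν.MatchesTo 2 I R
  matches_JA : f.JA.MatchesTo 0 I R
  spacelike : ∀ t ∈ I,
    0 < 1 - (Real.exp (f.μ.mean t (R t)) + Real.exp (f.ν.mean t (R t)) * deriv R t) ^ 2

/-- The fields solve Horava-Lifshitz gravity over the time set `I`, with the sphere of radius `R t`
as the surface of a star: all field equations and conservation laws hold in the distributional
sense. Their function parts are the equations in the interior and in the exterior; their layer parts
are the junction conditions across the sphere. -/
structure IsSolution (I : Set ℝ) : Prop where
  regular : Regular R f I
  hamiltonian : (hamiltonianIntegrand c R f).IntegralVanishes I R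
  momentum : (momentumConstraint c R f).Vanishes I R
  prepotential : (prepotentialEquation c R f).Vanishes I R
  gauge : (gaugeEquation c f).Vanishes I R
  dynamical_rr : (dynamicalRR c R f).Vanishes I R
  dynamical_θθ : (dynamicalΘΘ c R f).Vanishes I R
  energy_conservation : (energyIntegrand R f).IntegralVanishes I R
  momentum_conservation : (momentumConservation R f).Vanishes I R

end Equations

/-! ### Four-dimensional metrics -/

/-- The metric `-dt² + e^(2ν) (dr + e^(μ-ν) dt)² + r² (dθ² + sin²θ dφ²)` in coordinates
`(t, r, θ, φ)`. -/
def admMetric (μ ν r θ : ℝ) : Matrix (Fin 4) (Fin 4) ℝ :=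
  !![-1 + Real.exp (2 * μ), Real.exp (μ + ν), 0, 0;
     Real.exp (μ + ν), Real.exp (2 * ν), 0, 0;
     0, 0, r ^ 2, 0;
     0, 0, 0, r ^ 2 * Real.sin θ ^ 2]

/-- The function `1 - 2 M / r - Λ r² / 3`. -/
def sdsFactor (M Λ r : ℝ) : ℝ := 1 - 2 * M / r - Λ * r ^ 2 / 3

/-- The Schwarzschild-de Sitter metric of mass `M` (in units with `G = 1`) and cosmological
constant `Λ`, in static coordinates `(τ, r, θ, φ)`. -/
def sdsMetric (M Λ r θ : ℝ) : Matrix (Fin 4) (Fin 4) ℝ :=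
  Matrix.diagonal ![-sdsFactor M Λ r, (sdsFactor M Λ r)⁻¹, r ^ 2, r ^ 2 * Real.sin θ ^ 2]

/-- The Jacobian of `(τ, r, θ, φ) ↦ (τ + ψ r, r, θ, φ)`, where `d` is the derivative of `ψ`. -/
def timeShiftJacobian (d : ℝ) : Matrix (Fin 4) (Fin 4) ℝ :=
  !![1, d, 0, 0; 0, 1, 0, 0; 0, 0, 1, 0; 0, 0, 0, 1]

/-- On `r > r₀` the static metric with `μ = μ r` and `ν = ν r` is the Schwarzschild-de Sitter metric:
on each open interval without a horizon, a change of the time coordinate `t = τ + ψ r` brings it to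
the static form. -/
def IsSchwarzschildDeSitter (M Λ r₀ : ℝ) (μ ν : ℝ → ℝ) : Prop :=
  ∀ a b : ℝ, r₀ ≤ a → (∀ r ∈ Set.Ioo a b, sdsFactor M Λ r ≠ 0) →
    ∃ ψ : ℝ → ℝ, ∀ r ∈ Set.Ioo a b, DifferentiableAt ℝ ψ r ∧ ∀ θ : ℝ,
      (timeShiftJacobian (deriv ψ r)).transpose * admMetric (μ r) (ν r) r θ *
        timeShiftJacobian (deriv ψ r) = sdsMetric M Λ r θ

/-! ### The collapsing dust ball -/

section Collapse

variable (G Λ t₀ R₀ A₀ ρ₀ : ℝ)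

/-- `√(3Λ)/2 (t₀ - t)`. -/
def phase (t : ℝ) : ℝ := Real.sqrt (3 * Λ) / 2 * (t₀ - t)

/-- The interior Hubble function. -/
def hubble (t : ℝ) : ℝ := -Real.sqrt (Λ / 3) * Real.tanh (phase Λ t₀ t)

/-- The radius of the star. -/
def starRadius (t : ℝ) : ℝ := R₀ * Real.cosh (phase Λ t₀ t) ^ (2 / 3 : ℝ)

/-- The surface energy density of the shell. -/
def shellDensity (t : ℝ) : ℝ :=
  -R₀ * ((Λ + Real.pi * G * (1 + Real.cosh (Real.sqrt (3 * Λ) * (t₀ - t))) * ρ₀) /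
    (6 * Real.pi * G * Real.cosh (phase Λ t₀ t) ^ (4 / 3 : ℝ)))

/-- The exterior function `μ⁺`. -/
def exteriorμ (r : ℝ) : ℝ := 1 / 2 * Real.log (Λ * r ^ 2 / 3 - R₀ ^ 3 * Λ / (3 * r))

/-- The collapse solution: a ball of homogeneous dust of constant density `ρ₀`, surrounded by a shell
and by vacuum. -/
def dustCollapse : Fields where
  μ := piecewise (fun _ r => exteriorμ Λ R₀ r) (fun t r => Real.log (-hubble Λ t₀ t * r))
  ν := 0
  A := smooth fun _ _ => A₀
  ρH := ⟨fun _ _ => 0, fun _ _ => ρ₀, fun n t _ => if n = 0 then shellDensity G Λ t₀ R₀ ρ₀ t else 0⟩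
  v := 0
  pr := 0
  pθ := 0
  JA := 0
  Jφ := 0

end Collapse

end HoravaLifshitz

end

namespace HoravaLifshitz

namespace Layered

/-! With `ν = 0` the spatial slices are flat, so every curvature term of the potential drops out and
its variation is `-Λ` times the metric, whatever `g₂, …, g₈` are (`Frr_zero`, `Fθθ_zero`). Constant
`A` and vanishing currents remove the gauge terms, and equations 2, 3, 4 and 8 become `0 = 0`. What
remains concerns `μ` and `ρH`.

Put `W = e^(2μ)`. Outside, the `rr` equation reads `(r W)' = Λ r²`, solved by `exteriorW`; inside,
with `e^μ = -H r`, it reads `2 H' = Λ - 3 H²`, solved by the hyperbolic tangent. Since `R' = H R`,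
the quantity `(Λ - 3 H²) R³` is conserved, with value `Λ R₀³` (`hubble_sq_mul_starRadius_cube`).
This says `W(R) = H² R²`, so `μ` is continuous (`exteriorμ_starRadius`) and the `rr` equation has no
layer.

The `θθ` equation is of second order in `μ`, and its layers carry the factor `[μ]` or `e^μ + R'`.
Both vanish on the sphere, since `e^μ = -H R = -R'`: the sphere moves with the interior flow.

The Hamiltonian constraint then fixes the shell density `σ` by `R² σ + ρ₀ R³ / 3 = -Λ R₀³ / (6 π
G)`, and constancy of this sum is energy conservation. The exterior is a Painlevé–Gullstrand form,
made static by `ψ' = e^μ / f`. -/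

@[ext]
theorem ext {F G : Layered} (hp : ∀ t r, F.plus t r = G.plus t r)
    (hm : ∀ t r, F.minus t r = G.minus t r) (hl : ∀ n t r, F.layer n t r = G.layer n t r) :
    F = G := by
  obtain ⟨p, m, l⟩ := F
  obtain ⟨p', m', l'⟩ := G
  simp only [Layered.mk.injEq]
  exact ⟨funext₂ hp, funext₂ hm, funext fun n => funext₂ (hl n)⟩

/-! ### Function parts and layers of sums, products and derivatives. -/

section Projections

variable (F G : Layered) (a : ℝ) (k n : ℕ) (t r : ℝ)

theorem plus_add : (F + G).plus t r = F.plus t r + G.plus t r := rfl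
theorem minus_add : (F + G).minus t r = F.minus t r + G.minus t r := rfl
theorem layer_add : (F + G).layer n t r = F.layer n t r + G.layer n t r := rfl
theorem plus_sub : (F - G).plus t r = F.plus t r - G.plus t r := rfl
theorem minus_sub : (F - G).minus t r = F.minus t r - G.minus t r := rfl
theorem layer_sub : (F - G).layer n t r = F.layer n t r - G.layer n t r := rfl
theorem plus_neg : (-F).plus t r = -F.plus t r := rfl
theorem minus_neg : (-F).minus t r = -F.minus t r := rfl
theorem layer_neg : (-F).layer n t r = -F.layer n t r := rfl
theorem plus_smul : (a • F).plus t r = a * F.plus t r := rfl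
theorem minus_smul : (a • F).minus t r = a * F.minus t r := rfl
theorem layer_smul : (a • F).layer n t r = a * F.layer n t r := rfl
theorem plus_mul : (F * G).plus t r = F.plus t r * G.plus t r := rfl
theorem minus_mul : (F * G).minus t r = F.minus t r * G.minus t r := rfl
theorem layer_mul : (F * G).layer n t r =
    F.mean t r * G.layer n t r + F.layer n t r * G.mean t r := rfl
theorem plus_pow : (F ^ k).plus t r = F.plus t r ^ k := rfl
theorem minus_pow : (F ^ k).minus t r = F.minus t r ^ k := rfl
theorem layer_pow : (F ^ k).layer n t r = k * F.mean t r ^ (k - 1) * F.layer n t r := rfl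
theorem plus_dr : (dr F).plus t r = deriv (fun x => F.plus t x) r := rfl
theorem minus_dr : (dr F).minus t r = deriv (fun x => F.minus t x) r := rfl
theorem layer_zero_dr : (dr F).layer 0 t r =
    deriv (fun x => F.layer 0 t x) r + (F.plus t r - F.minus t r) := rfl
theorem layer_succ_dr : (dr F).layer (n + 1) t r =
    deriv (fun x => F.layer (n + 1) t x) r + F.layer n t r := rfl

variable (R : ℝ → ℝ)

theorem plus_dt : (dt R F).plus t r = deriv (fun x => F.plus x r) t := rfl
theorem minus_dt : (dt R F).minus t r = deriv (fun x => F.minus x r) t := rfl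
theorem layer_zero_dt : (dt R F).layer 0 t r =
    deriv (fun x => F.layer 0 x r) t - deriv R t * (F.plus t r - F.minus t r) := rfl
theorem layer_succ_dt : (dt R F).layer (n + 1) t r =
    deriv (fun x => F.layer (n + 1) x r) t - deriv R t * F.layer n t r := rfl

theorem plus_exp : (exp F).plus t r = Real.exp (F.plus t r) := rfl
theorem minus_exp : (exp F).minus t r = Real.exp (F.minus t r) := rfl
theorem layer_exp : (exp F).layer n t r = 0 := rfl

variable (f g : ℝ → ℝ → ℝ)

theorem plus_smooth : (smooth f).plus t r = f t r := rfl
theorem minus_smooth : (smooth f).minus t r = f t r := rfl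
theorem layer_smooth : (smooth f).layer n t r = 0 := rfl
theorem plus_piecewise : (piecewise f g).plus t r = f t r := rfl
theorem minus_piecewise : (piecewise f g).minus t r = g t r := rfl
theorem layer_piecewise : (piecewise f g).layer n t r = 0 := rfl

end Projections

/-! ### Smooth distributions form a subalgebra stable under differentiation -/

section Smooth

variable (F : Layered) (f g : ℝ → ℝ → ℝ) (a : ℝ) (k : ℕ)

theorem ofNat_eq_smooth [k.AtLeastTwo] :
    (OfNat.ofNat k : Layered) = smooth fun _ _ => (OfNat.ofNat k : ℝ) := rfl

theorem zero_eq_smooth : (0 : Layered) = smooth fun _ _ => 0 := by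
  change smooth (fun _ _ => ((0 : ℕ) : ℝ)) = _
  simp

theorem one_eq_smooth : (1 : Layered) = smooth fun _ _ => 1 := by
  change smooth (fun _ _ => ((1 : ℕ) : ℝ)) = _
  simp

theorem mean_smooth (t r : ℝ) : (smooth f).mean t r = f t r := by
  simp [mean, smooth]

theorem smooth_add : smooth f + smooth g = smooth fun t r => f t r + g t r := by
  ext <;> simp [plus_add, minus_add, layer_add, smooth]

theorem smooth_sub : smooth f - smooth g = smooth fun t r => f t r - g t r := by
  ext <;> simp [plus_sub, minus_sub, layer_sub, smooth]

theorem smooth_neg : -smooth f = smooth fun t r => -f t r := by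
  ext <;> simp [plus_neg, minus_neg, layer_neg, smooth]

theorem smooth_smul : a • smooth f = smooth fun t r => a * f t r := by
  ext <;> simp [plus_smul, minus_smul, layer_smul, smooth]

theorem smooth_mul : smooth f * smooth g = smooth fun t r => f t r * g t r := by
  ext <;> simp [plus_mul, minus_mul, layer_mul, smooth]

theorem smooth_pow : smooth f ^ k = smooth fun t r => f t r ^ k := by
  ext <;> simp [plus_pow, minus_pow, layer_pow, smooth]

theorem smooth_exp : exp (smooth f) = smooth fun t r => Real.exp (f t r) := rfl

theorem smooth_dr : dr (smooth f) = smooth fun t r => deriv (f t) r := by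
  ext n t r
  · rfl
  · rfl
  · cases n <;> simp [dr, smooth]

theorem smooth_dt (R : ℝ → ℝ) : dt R (smooth f) = smooth fun t r => deriv (fun x => f x r) t := by
  ext n t r
  · rfl
  · rfl
  · cases n <;> simp [dt, smooth]

theorem zero_smul_eq : (0 : ℝ) • F = smooth fun _ _ => 0 := by
  ext <;> simp [plus_smul, minus_smul, layer_smul, smooth]

theorem one_smul_eq : (1 : ℝ) • F = F := by
  ext <;> simp [plus_smul, minus_smul, layer_smul]

/-- The product of layered distributions is not associative, because the mean of a product of two
jumping functions is not the product of their means. Ring identities are thus unavailable, and units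
and zeros are removed term by term. -/
theorem smooth_zero_mul : (smooth fun _ _ => 0) * F = smooth fun _ _ => 0 := by
  ext <;> simp [plus_mul, minus_mul, layer_mul, mean_smooth, plus_smooth, minus_smooth,
    layer_smooth]

theorem mul_smooth_zero : F * (smooth fun _ _ => 0) = smooth fun _ _ => 0 := by
  ext <;> simp [plus_mul, minus_mul, layer_mul, mean_smooth, plus_smooth, minus_smooth,
    layer_smooth]

theorem mul_smooth_one : F * (smooth fun _ _ => 1) = F := by
  ext <;> simp [plus_mul, minus_mul, layer_mul, mean_smooth, plus_smooth, minus_smooth,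
    layer_smooth]

theorem smooth_zero_add : (smooth fun _ _ => 0) + F = F := by
  ext <;> simp [plus_add, minus_add, layer_add, smooth]

theorem add_smooth_zero : F + (smooth fun _ _ => 0) = F := by
  ext <;> simp [plus_add, minus_add, layer_add, smooth]

theorem sub_smooth_zero : F - (smooth fun _ _ => 0) = F := by
  ext <;> simp [plus_sub, minus_sub, layer_sub, smooth]

end Smooth

/-! ### The variation of the potential in flat space -/

theorem potential_zero (c : Couplings) : potential 0 c = smooth fun _ _ => 2 * c.Λ := by
  simp [potential, scalarR, ricciR, ricciΘ, ricciSq, ricciCube, laplacian, gradRicciSq, invRadius,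
    radius, zero_eq_smooth, one_eq_smooth, ofNat_eq_smooth, smooth_add, smooth_sub, smooth_neg,
    smooth_smul, smooth_mul, smooth_pow, smooth_exp, smooth_dr]

/-- At `ν = 0` every exponential is `1` and every derivative is `0`; in each higher tensor the
constants cancel (`6 + 1 - 7`, `4 + 1 - 5`, …) or a factor `e^(2ν) - 1` occurs. Only `F0rr`
survives. -/
theorem Frr_zero (c : Couplings) : Frr 0 c = smooth fun _ _ => -c.Λ := by
  simp only [Frr, F0rr, F1rr, F2rr, F3rr, F4rr, F5rr, F6rr, F7rr, F8rr, invRadius,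
    radius, zero_eq_smooth, one_eq_smooth, ofNat_eq_smooth, smooth_add, smooth_sub, smooth_neg,
    smooth_smul, smooth_mul, smooth_pow, smooth_exp, smooth_dr, deriv_const, mul_zero, Real.exp_zero]
  congr 1
  funext t r
  ring

theorem Fθθ_zero (c : Couplings) : Fθθ 0 c = smooth fun _ r => -c.Λ * r ^ 2 := by
  simp only [Fθθ, F0θθ, F1θθ, F2θθ, F3θθ, F4θθ, F5θθ, F6θθ, F7θθ, F8θθ, invRadius,
    radius, zero_eq_smooth, one_eq_smooth, ofNat_eq_smooth, smooth_add, smooth_sub, smooth_neg,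
    smooth_smul, smooth_mul, smooth_pow, smooth_exp, smooth_dr, deriv_const, mul_zero, Real.exp_zero]
  congr 1
  funext t r
  ring

end Layered

open Layered

/-! ### The field equations for the dust ball -/

section DustEquations

variable (c : Couplings) (t₀ R₀ A₀ ρ₀ : ℝ) (R : ℝ → ℝ)

theorem momentumConstraint_dustCollapse (hlam : c.lam = 1) :
    momentumConstraint c R (dustCollapse c.G c.Λ t₀ R₀ A₀ ρ₀) = smooth fun _ _ => 0 := by
  simp [momentumConstraint, dustCollapse, hlam, zero_smul_eq, radius,
    zero_eq_smooth, ofNat_eq_smooth, smooth_add, smooth_sub,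
    smooth_smul, smooth_mul, smooth_pow, smooth_dr, smooth_dt, mul_smooth_zero, smooth_zero_mul]

theorem gaugeFactor_dustCollapse (hΛg : c.Λg = 0) :
    gaugeFactor c (dustCollapse c.G c.Λ t₀ R₀ A₀ ρ₀) = smooth fun _ _ => 0 := by
  simp [gaugeFactor, dustCollapse, hΛg, zero_smul_eq, radius, one_eq_smooth,
    zero_eq_smooth, ofNat_eq_smooth, smooth_add, smooth_sub, smooth_mul, smooth_exp]

theorem prepotentialEquation_dustCollapse (hlam : c.lam = 1) (hΛg : c.Λg = 0) :
    prepotentialEquation c R (dustCollapse c.G c.Λ t₀ R₀ A₀ ρ₀) = smooth fun _ _ => 0 := by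
  rw [prepotentialEquation, gaugeFactor_dustCollapse c t₀ R₀ A₀ ρ₀ hΛg]
  simp [dustCollapse, hlam, hΛg, zero_smul_eq, radius,
    zero_eq_smooth, ofNat_eq_smooth, smooth_add, smooth_sub,
    smooth_smul, smooth_mul, smooth_pow, smooth_dr, smooth_dt, mul_smooth_zero, smooth_zero_mul]

theorem gaugeEquation_dustCollapse (hΛg : c.Λg = 0) :
    gaugeEquation c (dustCollapse c.G c.Λ t₀ R₀ A₀ ρ₀) = smooth fun _ _ => 0 := by
  rw [gaugeEquation, gaugeFactor_dustCollapse c t₀ R₀ A₀ ρ₀ hΛg]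
  simp [dustCollapse, radius, zero_eq_smooth, ofNat_eq_smooth, smooth_sub,
    smooth_smul, smooth_mul, smooth_pow, smooth_dr, mul_smooth_zero]

theorem momentumConservation_dustCollapse :
    momentumConservation R (dustCollapse c.G c.Λ t₀ R₀ A₀ ρ₀) = smooth fun _ _ => 0 := by
  simp [momentumConservation, dustCollapse, zero_eq_smooth, ofNat_eq_smooth, smooth_add,
    smooth_sub, invRadius, smooth_smul, smooth_mul, smooth_dr, smooth_dt, mul_smooth_zero,
    smooth_zero_mul]

theorem energyIntegrand_dustCollapse :
    energyIntegrand R (dustCollapse c.G c.Λ t₀ R₀ A₀ ρ₀) =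
      (smooth fun _ r => r ^ 2) * dt R (dustCollapse c.G c.Λ t₀ R₀ A₀ ρ₀).ρH := by
  simp [energyIntegrand, dustCollapse, radius, smooth_exp, zero_eq_smooth, ofNat_eq_smooth,
    smooth_mul, smooth_pow, smooth_dt, mul_smooth_zero, smooth_zero_mul, sub_smooth_zero,
    add_smooth_zero]

/-- The smooth coefficients are merged, but the products with `μ` stay as they are, since `μ` is
only piecewise smooth. -/
theorem hamiltonianIntegrand_dustCollapse (hlam : c.lam = 1) :
    hamiltonianIntegrand c R (dustCollapse c.G c.Λ t₀ R₀ A₀ ρ₀) =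
      let μ := (dustCollapse c.G c.Λ t₀ R₀ A₀ ρ₀).μ
      ((smooth fun _ _ => 2 * c.Λ)
        - (smooth fun _ r => 2 * r⁻¹ ^ 2) * exp ((smooth fun _ _ => 2) * μ)
          * ((smooth fun _ r => 2 * r) * dr μ + smooth fun _ _ => 1)
        + (4 * Real.pi * c.G) • (dustCollapse c.G c.Λ t₀ R₀ A₀ ρ₀).ρH)
        * smooth fun _ r => r ^ 2 := by
  have hν : (dustCollapse c.G c.Λ t₀ R₀ A₀ ρ₀).ν = 0 := rfl
  rw [hamiltonianIntegrand, kinetic, hν, potential_zero]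
  generalize (dustCollapse c.G c.Λ t₀ R₀ A₀ ρ₀).μ = μ
  simp only [hlam, sub_self, zero_smul_eq, one_smul_eq, radius, smooth_exp, one_eq_smooth,
    zero_eq_smooth, ofNat_eq_smooth, invRadius, deriv_const, Real.exp_zero,
    smooth_mul, smooth_pow, smooth_dt, mul_smooth_zero, smooth_zero_mul, mul_smooth_one,
    sub_smooth_zero, smooth_zero_add]
  congr 2
  ext <;> simp only [plus_add, minus_add, layer_add, plus_sub, minus_sub, layer_sub,
    plus_smooth, minus_smooth, layer_smooth] <;> ring

theorem dynamicalRR_dustCollapse (hlam : c.lam = 1) (hΛg : c.Λg = 0) :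
    dynamicalRR c R (dustCollapse c.G c.Λ t₀ R₀ A₀ ρ₀) =
      let μ := (dustCollapse c.G c.Λ t₀ R₀ A₀ ρ₀).μ
      ((smooth fun _ _ => 2) * dr μ + smooth fun _ r => r⁻¹) * exp ((smooth fun _ _ => 2) * μ)
        - (smooth fun _ _ => 2) * exp μ * dt R μ + smooth fun _ r => -c.Λ * r := by
  have hν : (dustCollapse c.G c.Λ t₀ R₀ A₀ ρ₀).ν = 0 := rfl
  have hA : (dustCollapse c.G c.Λ t₀ R₀ A₀ ρ₀).A = smooth fun _ _ => A₀ := rfl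
  have hp : (dustCollapse c.G c.Λ t₀ R₀ A₀ ρ₀).pr = 0 := rfl
  rw [dynamicalRR, gaugeTerm, FArr, hν, Frr_zero, hA, hp]
  generalize (dustCollapse c.G c.Λ t₀ R₀ A₀ ρ₀).μ = μ
  simp only [hlam, hΛg, sub_self, zero_smul_eq, one_smul_eq, radius, smooth_exp, one_eq_smooth,
    zero_eq_smooth, ofNat_eq_smooth, smooth_add, smooth_sub, invRadius, deriv_const, mul_zero,
    zero_mul, Real.exp_zero, smooth_smul, smooth_mul, smooth_pow, smooth_dr, smooth_dt,
    mul_smooth_one, add_smooth_zero, smooth_zero_add, smooth_neg, sub_zero, mul_one]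
  norm_num [mul_comm]

theorem dynamicalΘΘ_dustCollapse (hlam : c.lam = 1) (hΛg : c.Λg = 0) :
    dynamicalΘΘ c R (dustCollapse c.G c.Λ t₀ R₀ A₀ ρ₀) =
      let μ := (dustCollapse c.G c.Λ t₀ R₀ A₀ ρ₀).μ
      ((smooth fun _ r => r) * dr (dr μ) + (smooth fun _ _ => 2) * dr μ
          + (2 : ℝ) • ((smooth fun _ r => r) * dr μ ^ 2)) * exp ((smooth fun _ _ => 2) * μ)
        - (dt R μ + (smooth fun _ r => r) * dr μ * dt R μ + (smooth fun _ r => r) * dt R (dr μ))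
          * exp μ
        + smooth fun _ r => -(r⁻¹ * (c.Λ * r ^ 2)) := by
  have hν : (dustCollapse c.G c.Λ t₀ R₀ A₀ ρ₀).ν = 0 := rfl
  have hA : (dustCollapse c.G c.Λ t₀ R₀ A₀ ρ₀).A = smooth fun _ _ => A₀ := rfl
  have hp : (dustCollapse c.G c.Λ t₀ R₀ A₀ ρ₀).pθ = 0 := rfl
  rw [dynamicalΘΘ, gaugeTerm, FAθθ, hν, Fθθ_zero, hA, hp]
  generalize (dustCollapse c.G c.Λ t₀ R₀ A₀ ρ₀).μ = μ
  simp only [hlam, hΛg, sub_self, one_smul_eq, radius, smooth_exp, one_eq_smooth,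
    zero_eq_smooth, ofNat_eq_smooth, smooth_add, smooth_sub, invRadius, deriv_const, mul_zero,
    zero_mul, Real.exp_zero, smooth_smul, smooth_mul, smooth_pow, smooth_dr, smooth_dt,
    mul_smooth_zero, mul_smooth_one, sub_smooth_zero, add_smooth_zero,
    smooth_zero_add, mul_one]
  norm_num [one_smul_eq, add_smooth_zero]

end DustEquations
-- Hubble function, star radius and their evolution equations.
section Calculus

variable {Λ t₀ R₀ t r : ℝ}

theorem phase_pos (hΛ : 0 < Λ) (ht : t < t₀) : 0 < phase Λ t₀ t :=
  mul_pos (by positivity) (sub_pos.2 ht)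

theorem hasDerivAt_phase (Λ t₀ t : ℝ) :
    HasDerivAt (phase Λ t₀) (-(Real.sqrt (3 * Λ) / 2)) t := by
  exact (((hasDerivAt_id t).const_sub t₀).const_mul (Real.sqrt (3 * Λ) / 2)).congr_deriv
    (by ring)

theorem sqrt_div_three (Λ : ℝ) : Real.sqrt (Λ / 3) = Real.sqrt (3 * Λ) / 3 := by
  rw [show Λ / 3 = 3 * Λ / 3 ^ 2 by ring, Real.sqrt_div' _ (by norm_num),
    Real.sqrt_sq (by norm_num)]

theorem hubble_neg (hΛ : 0 < Λ) (ht : t < t₀) : hubble Λ t₀ t < 0 := by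
  have h1 := Real.sinh_pos_iff.2 (phase_pos hΛ ht)
  have h2 := Real.cosh_pos (phase Λ t₀ t)
  rw [hubble, Real.tanh_eq_sinh_div_cosh]
  have : 0 < Real.sqrt (Λ / 3) * (Real.sinh (phase Λ t₀ t) / Real.cosh (phase Λ t₀ t)) := by
    positivity
  linarith

theorem hubble_sq (hΛ : 0 < Λ) (t₀ t : ℝ) :
    Λ - 3 * hubble Λ t₀ t ^ 2 = Λ / Real.cosh (phase Λ t₀ t) ^ 2 := by
  have h1 := Real.sq_sqrt (show 0 ≤ Λ / 3 by positivity)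
  have h2 := Real.cosh_sq (phase Λ t₀ t)
  have h3 := Real.cosh_pos (phase Λ t₀ t)
  rw [hubble, Real.tanh_eq_sinh_div_cosh, mul_pow, neg_sq, h1, div_pow, h2]
  have : Real.sinh (phase Λ t₀ t) ^ 2 + 1 ≠ 0 := by positivity
  field_simp
  ring

/-- This Riccati equation is the interior `rr` equation. It holds since `tanh' = 1 / cosh²` and
`√(Λ/3) · √(3Λ)/2 = Λ/2`. -/
theorem hasDerivAt_hubble (hΛ : 0 < Λ) (t₀ t : ℝ) :
    HasDerivAt (hubble Λ t₀) ((Λ - 3 * hubble Λ t₀ t ^ 2) / 2) t := by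
  have hc := (Real.cosh_pos (phase Λ t₀ t)).ne'
  have h := (((hasDerivAt_phase Λ t₀ t).sinh.div (hasDerivAt_phase Λ t₀ t).cosh hc)).const_mul
    (-Real.sqrt (Λ / 3))
  rw [hubble_sq hΛ]
  refine (h.congr_deriv ?_).congr_of_eventuallyEq
    (Filter.Eventually.of_forall fun s => by simp [hubble, Real.tanh_eq_sinh_div_cosh])
  have h1 := Real.sq_sqrt (show 0 ≤ 3 * Λ by positivity)
  have h2 := Real.cosh_sq (phase Λ t₀ t)
  rw [sqrt_div_three]
  field_simp
  nlinarith

theorem starRadius_pos (hR₀ : 0 < R₀) (Λ t₀ t : ℝ) : 0 < starRadius Λ t₀ R₀ t :=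
  mul_pos hR₀ (Real.rpow_pos_of_pos (Real.cosh_pos _) _)

theorem starRadius_cube (Λ t₀ R₀ t : ℝ) :
    starRadius Λ t₀ R₀ t ^ 3 = R₀ ^ 3 * Real.cosh (phase Λ t₀ t) ^ 2 := by
  rw [starRadius, mul_pow, ← Real.rpow_natCast (_ ^ (2 / 3 : ℝ)),
    ← Real.rpow_mul (Real.cosh_pos _).le]
  norm_num

/-- The conserved quantity that matches the two sides: the powers `cosh⁻²` and `cosh²` cancel. -/
theorem hubble_sq_mul_starRadius_cube (hΛ : 0 < Λ) (t₀ R₀ t : ℝ) :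
    (Λ - 3 * hubble Λ t₀ t ^ 2) * starRadius Λ t₀ R₀ t ^ 3 = Λ * R₀ ^ 3 := by
  have h3 := Real.cosh_pos (phase Λ t₀ t)
  rw [hubble_sq hΛ, starRadius_cube]
  field_simp

theorem lt_starRadius (hΛ : 0 < Λ) (hR₀ : 0 < R₀) (ht : t < t₀) : R₀ < starRadius Λ t₀ R₀ t := by
  have := Real.one_lt_rpow (Real.one_lt_cosh.2 (phase_pos hΛ ht).ne')
    (show (0 : ℝ) < 2 / 3 by norm_num)
  rw [starRadius]
  nlinarith

/-- The exponent `2/3` turns the rate `√(3Λ)/2` of the phase into `√(3Λ)/3 = √(Λ/3)`, so the sphere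
follows the interior flow. -/
theorem hasDerivAt_starRadius (Λ t₀ R₀ t : ℝ) :
    HasDerivAt (starRadius Λ t₀ R₀) (hubble Λ t₀ t * starRadius Λ t₀ R₀ t) t := by
  have hc := Real.cosh_pos (phase Λ t₀ t)
  have h := ((hasDerivAt_phase Λ t₀ t).cosh.rpow_const (p := 2 / 3) (Or.inl hc.ne')).const_mul R₀
  refine h.congr_deriv ?_
  rw [starRadius, hubble, Real.tanh_eq_sinh_div_cosh, sqrt_div_three, Real.rpow_sub_one hc.ne']
  field_simp

theorem deriv_starRadius (Λ t₀ R₀ t : ℝ) :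
    deriv (starRadius Λ t₀ R₀) t = hubble Λ t₀ t * starRadius Λ t₀ R₀ t :=
  (hasDerivAt_starRadius Λ t₀ R₀ t).deriv

theorem strictAntiOn_starRadius (hΛ : 0 < Λ) (hR₀ : 0 < R₀) (t₀ : ℝ) :
    StrictAntiOn (starRadius Λ t₀ R₀) (Set.Iio t₀) := by
  refine strictAntiOn_of_deriv_neg (convex_Iio t₀)
    (fun t _ => (hasDerivAt_starRadius Λ t₀ R₀ t).continuousAt.continuousWithinAt) fun t ht => ?_
  rw [interior_Iio] at ht
  rw [deriv_starRadius]
  exact mul_neg_of_neg_of_pos (hubble_neg hΛ ht) (starRadius_pos hR₀ Λ t₀ t)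

theorem contDiff_starRadius (Λ t₀ R₀ : ℝ) : ContDiff ℝ 5 (starRadius Λ t₀ R₀) := by
  unfold starRadius phase
  refine contDiff_const.mul (ContDiff.rpow_const_of_ne ?_ fun t => (Real.cosh_pos _).ne')
  fun_prop

/-! ### The exterior field -/

/-- The function `e^(2μ)` of the exterior, `2 M / r + Λ r² / 3` with `M = -Λ R₀³ / 6`. -/
noncomputable def exteriorW (Λ R₀ r : ℝ) : ℝ := Λ * r ^ 2 / 3 - R₀ ^ 3 * Λ / (3 * r)

theorem exteriorW_pos (hΛ : 0 < Λ) (hR₀ : 0 < R₀) (hr : R₀ < r) : 0 < exteriorW Λ R₀ r := by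
  have hr0 : 0 < r := hR₀.trans hr
  have : exteriorW Λ R₀ r = Λ * (r ^ 3 - R₀ ^ 3) / (3 * r) := by
    rw [exteriorW]
    field_simp
  rw [this]
  have : 0 < r ^ 3 - R₀ ^ 3 := sub_pos.2 (pow_lt_pow_left₀ hr hR₀.le (by norm_num))
  positivity

theorem exp_two_mul_exteriorμ (hΛ : 0 < Λ) (hR₀ : 0 < R₀) (hr : R₀ < r) :
    Real.exp (2 * exteriorμ Λ R₀ r) = exteriorW Λ R₀ r := by
  rw [exteriorμ, ← mul_assoc]
  norm_num
  exact Real.exp_log (exteriorW_pos hΛ hR₀ hr)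

/-- Written as `W' = Λ r - W / r`, that is `(r W)' = Λ r²`, so that the field equations can be
checked with `W` left unexpanded. -/
theorem hasDerivAt_exteriorW (Λ R₀ : ℝ) (hr : r ≠ 0) :
    HasDerivAt (exteriorW Λ R₀) (Λ * r - exteriorW Λ R₀ r / r) r := by
  have h := (((hasDerivAt_pow 2 r).const_mul Λ).div_const 3).sub
    ((hasDerivAt_inv hr).const_mul (R₀ ^ 3 * Λ / 3))
  refine (h.congr_deriv ?_).congr_of_eventuallyEq (Filter.Eventually.of_forall fun s => ?_)
  · rw [exteriorW]
    field_simp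
    ring
  · simp only [exteriorW, Pi.sub_apply]
    rw [← div_div]
    ring_nf

/-- The derivative of the exterior `μ`. -/
theorem hasDerivAt_exteriorμ (hΛ : 0 < Λ) (hR₀ : 0 < R₀) (hr : R₀ < r) :
    HasDerivAt (exteriorμ Λ R₀) ((Λ * r / exteriorW Λ R₀ r - r⁻¹) / 2) r := by
  have hr0 : r ≠ 0 := (hR₀.trans hr).ne'
  have hW := (exteriorW_pos hΛ hR₀ hr).ne'
  refine (((hasDerivAt_exteriorW Λ R₀ hr0).log hW).const_mul (1 / 2)).congr_deriv ?_
  field_simp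

theorem deriv_deriv_exteriorμ (hΛ : 0 < Λ) (hR₀ : 0 < R₀) (hr : R₀ < r) :
    deriv (deriv (exteriorμ Λ R₀)) r =
      ((Λ * exteriorW Λ R₀ r - Λ * r * (Λ * r - exteriorW Λ R₀ r / r)) / exteriorW Λ R₀ r ^ 2
        + (r ^ 2)⁻¹) / 2 := by
  have hr0 : r ≠ 0 := (hR₀.trans hr).ne'
  have hW := (exteriorW_pos hΛ hR₀ hr).ne'
  have h : deriv (exteriorμ Λ R₀) =ᶠ[nhds r] fun s => (Λ * s / exteriorW Λ R₀ s - s⁻¹) / 2 := by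
    filter_upwards [Ioi_mem_nhds hr] with s hs
    exact (hasDerivAt_exteriorμ hΛ hR₀ hs).deriv
  rw [h.deriv_eq]
  refine ((((((hasDerivAt_id r).const_mul Λ).div (hasDerivAt_exteriorW Λ R₀ hr0) hW).sub
    (hasDerivAt_inv hr0)).div_const 2).congr_deriv ?_).deriv
  simp

theorem exteriorW_starRadius (hΛ : 0 < Λ) (hR₀ : 0 < R₀) (t₀ t : ℝ) :
    exteriorW Λ R₀ (starRadius Λ t₀ R₀ t) = hubble Λ t₀ t ^ 2 * starRadius Λ t₀ R₀ t ^ 2 := by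
  have hR := starRadius_pos hR₀ Λ t₀ t
  have := hubble_sq_mul_starRadius_cube hΛ t₀ R₀ t
  rw [exteriorW]
  field_simp
  linarith

/-! ### The interior field -/

theorem neg_hubble_mul_pos (hΛ : 0 < Λ) (ht : t < t₀) (hr : 0 < r) : 0 < -hubble Λ t₀ t * r :=
  mul_pos (neg_pos.2 (hubble_neg hΛ ht)) hr

theorem hasDerivAt_interiorμ_radius (hΛ : 0 < Λ) (ht : t < t₀) (hr : r ≠ 0) :
    HasDerivAt (fun x => Real.log (-hubble Λ t₀ t * x)) r⁻¹ r := by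
  have hH := (hubble_neg hΛ ht).ne
  refine (((hasDerivAt_id r).const_mul (-hubble Λ t₀ t)).log
    (mul_ne_zero (neg_ne_zero.2 hH) hr)).congr_deriv ?_
  simp only [id]
  field_simp

theorem hasDerivAt_interiorμ_time (hΛ : 0 < Λ) (ht : t < t₀) (hr : r ≠ 0) :
    HasDerivAt (fun s => Real.log (-hubble Λ t₀ s * r))
      ((Λ - 3 * hubble Λ t₀ t ^ 2) / 2 / hubble Λ t₀ t) t := by
  have hH := (hubble_neg hΛ ht).ne
  refine (((hasDerivAt_hubble hΛ t₀ t).neg.mul_const r).log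
    (mul_ne_zero (neg_ne_zero.2 hH) hr)).congr_deriv ?_
  simp only [Pi.neg_apply]
  field_simp

theorem deriv_deriv_interiorμ_radius (hΛ : 0 < Λ) (ht : t < t₀) (hr : r ≠ 0) :
    deriv (deriv fun x => Real.log (-hubble Λ t₀ t * x)) r = -(r ^ 2)⁻¹ := by
  have h : deriv (fun x => Real.log (-hubble Λ t₀ t * x)) =ᶠ[nhds r] fun x => x⁻¹ := by
    filter_upwards [isOpen_ne.mem_nhds hr] with s hs
    exact (hasDerivAt_interiorμ_radius hΛ ht hs).deriv
  rw [h.deriv_eq, (hasDerivAt_inv hr).deriv]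

/-- The logarithm splits into a function of time plus `log r`, so the mixed derivative vanishes. -/
theorem deriv_deriv_interiorμ_time (hΛ : 0 < Λ) (ht : t < t₀) (hr : r ≠ 0) :
    deriv (fun s => deriv (fun x => Real.log (-hubble Λ t₀ s * x)) r) t = 0 := by
  have h : (fun s => deriv (fun x => Real.log (-hubble Λ t₀ s * x)) r) =ᶠ[nhds t]
      fun _ => r⁻¹ := by
    filter_upwards [Iio_mem_nhds ht] with s hs
    exact (hasDerivAt_interiorμ_radius hΛ hs hr).deriv
  rw [h.deriv_eq, deriv_const]

theorem exteriorμ_starRadius (hΛ : 0 < Λ) (hR₀ : 0 < R₀) (t₀ t : ℝ) :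
    exteriorμ Λ R₀ (starRadius Λ t₀ R₀ t) =
      Real.log (-hubble Λ t₀ t * starRadius Λ t₀ R₀ t) := by
  have h := exteriorW_starRadius hΛ hR₀ t₀ t
  rw [exteriorW] at h
  -- `H² R²` is rewritten as the square of `-H R`; `Real.log_pow` then cancels the factor `1 / 2`
  -- without any sign condition.
  rw [exteriorμ, h, ← mul_pow, ← neg_sq, ← neg_mul, Real.log_pow]
  push_cast
  ring

/-! ### The shell -/

/-- By `1 + cosh 2x = 2 cosh² x` the density is rational in the star radius, which reduces the
Hamiltonian and energy laws to algebra in `R` and `H`. -/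
theorem shellDensity_eq {G : ℝ} (hG : 0 < G) (hR₀ : 0 < R₀) (Λ t₀ ρ₀ t : ℝ) :
    shellDensity G Λ t₀ R₀ ρ₀ t =
      -(Λ * R₀ ^ 3 + 2 * Real.pi * G * ρ₀ * starRadius Λ t₀ R₀ t ^ 3) /
        (6 * Real.pi * G * starRadius Λ t₀ R₀ t ^ 2) := by
  have hc := Real.cosh_pos (phase Λ t₀ t)
  have hsq : starRadius Λ t₀ R₀ t ^ 2 = R₀ ^ 2 * Real.cosh (phase Λ t₀ t) ^ (4 / 3 : ℝ) := by
    rw [starRadius, mul_pow, ← Real.rpow_natCast (_ ^ (2 / 3 : ℝ)), ← Real.rpow_mul hc.le]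
    norm_num
  have h2 : Real.cosh (Real.sqrt (3 * Λ) * (t₀ - t)) =
      2 * Real.cosh (phase Λ t₀ t) ^ 2 - 1 := by
    rw [show Real.sqrt (3 * Λ) * (t₀ - t) = 2 * phase Λ t₀ t by rw [phase]; ring,
      Real.cosh_two_mul, Real.cosh_sq (phase Λ t₀ t)]
    ring
  have hp := Real.rpow_pos_of_pos hc (4 / 3)
  have hpi := Real.pi_pos
  rw [shellDensity, h2, starRadius_cube, hsq]
  field_simp
  ring

theorem hasDerivAt_shellDensity {G : ℝ} (hG : 0 < G) (hR₀ : 0 < R₀) (Λ t₀ ρ₀ t : ℝ) :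
    HasDerivAt (shellDensity G Λ t₀ R₀ ρ₀)
      (hubble Λ t₀ t * (2 * Λ * R₀ ^ 3 - 2 * Real.pi * G * ρ₀ * starRadius Λ t₀ R₀ t ^ 3) /
        (6 * Real.pi * G * starRadius Λ t₀ R₀ t ^ 2)) t := by
  have hR := starRadius_pos hR₀ Λ t₀ t
  have hpi := Real.pi_pos
  have hd := hasDerivAt_starRadius Λ t₀ R₀ t
  have h := ((((hd.pow 3).const_mul (2 * Real.pi * G * ρ₀)).const_add (Λ * R₀ ^ 3)).neg).div
    ((hd.pow 2).const_mul (6 * Real.pi * G)) (by simp only [Pi.pow_apply]; positivity)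
  refine (h.congr_deriv ?_).congr_of_eventuallyEq
    (Filter.Eventually.of_forall fun s => ?_)
  · simp only [Pi.pow_apply, Pi.neg_apply]
    field_simp
    ring
  · simp [shellDensity_eq hG hR₀]

end Calculus
-- A criterion for layers of order at most one to vanish.
namespace Layered

/-- A distribution with layers `f δ + g δ'` vanishes if `f = 0`, `g = 0` and `g' = 0` on the
sphere. -/
theorem Vanishes.of_layers {I : Set ℝ} {R : ℝ → ℝ} {F : Layered}
    (hp : ∀ t ∈ I, ∀ r, R t < r → F.plus t r = 0)
    (hm : ∀ t ∈ I, ∀ r, 0 < r → r < R t → F.minus t r = 0)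
    (h0 : ∀ t ∈ I, F.layer 0 t (R t) = 0)
    (h1 : ∀ t ∈ I, F.layer 1 t (R t) = 0)
    (h1' : ∀ t ∈ I, HasDerivAt (F.layer 1 t) 0 (R t))
    (h2 : ∀ n t r, F.layer (n + 2) t r = 0) : F.Vanishes I R := by
  refine ⟨hp, hm, 2, fun n hn t _ r => ?_, fun t ht ψ hψ _ _ => ?_⟩
  · obtain ⟨k, rfl⟩ := Nat.exists_eq_add_of_le' hn
    exact h2 k t r
  · have hd := (h1' t ht).mul (hψ.differentiable (by simp) (R t)).hasDerivAt
    have : deriv (fun r => F.layer 1 t r * ψ r) (R t) = 0 := by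
      refine hd.deriv.trans ?_
      simp [h1 t ht]
    simp [Finset.sum_range_succ, h0 t ht, this]

theorem vanishes_smooth_zero (I : Set ℝ) (R : ℝ → ℝ) :
    (smooth fun _ _ => 0).Vanishes I R :=
  .of_layers (fun _ _ _ _ => rfl) (fun _ _ _ _ _ => rfl) (fun _ _ => rfl) (fun _ _ => rfl)
    (fun t _ => hasDerivAt_const (R t) 0) fun _ _ _ => rfl

end Layered

/-! ### Bulk equations, junction conditions and exterior geometry. -/

section Solution

variable {c : Couplings} {t₀ R₀ : ℝ} (A₀ ρ₀ : ℝ)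

theorem exp_interiorμ {Λ t r : ℝ} (hΛ : 0 < Λ) (ht : t < t₀) (hr : 0 < r) :
    Real.exp (Real.log (-hubble Λ t₀ t * r)) = -hubble Λ t₀ t * r :=
  Real.exp_log (neg_hubble_mul_pos hΛ ht hr)

theorem exp_two_mul_interiorμ {Λ t r : ℝ} (hΛ : 0 < Λ) (ht : t < t₀) (hr : 0 < r) :
    Real.exp (2 * Real.log (-hubble Λ t₀ t * r)) = hubble Λ t₀ t ^ 2 * r ^ 2 := by
  rw [two_mul, Real.exp_add, exp_interiorμ hΛ ht hr]
  ring

/-- Only first derivatives of `μ` occur, so the only layer is `δ`, with a coefficient proportional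
to the jump of `μ`. -/
theorem dynamicalRR_vanishes (hΛ : 0 < c.Λ) (hlam : c.lam = 1) (hΛg : c.Λg = 0) (hR₀ : 0 < R₀) :
    (dynamicalRR c (starRadius c.Λ t₀ R₀) (dustCollapse c.G c.Λ t₀ R₀ A₀ ρ₀)).Vanishes
      (Set.Iio t₀) (starRadius c.Λ t₀ R₀) := by
  rw [dynamicalRR_dustCollapse c t₀ R₀ A₀ ρ₀ _ hlam hΛg]
  refine .of_layers (fun t ht r hr => ?_) (fun t ht r hr _ => ?_) (fun t ht => ?_)
    (fun t ht => ?_) (fun t ht => ?_) (fun n t r => ?_)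
  · have hr' := (lt_starRadius hΛ hR₀ ht).trans hr
    have hr0 := (hR₀.trans hr').ne'
    have hW := (exteriorW_pos hΛ hR₀ hr').ne'
    simp only [dustCollapse, plus_add, plus_sub, plus_mul, plus_smooth, plus_dr, plus_dt, plus_exp,
      plus_piecewise, deriv_const, exp_two_mul_exteriorμ hΛ hR₀ hr',
      (hasDerivAt_exteriorμ hΛ hR₀ hr').deriv]
    field_simp
    ring
  · have hH := (hubble_neg hΛ ht).ne
    simp only [dustCollapse, minus_add, minus_sub, minus_mul, minus_smooth, minus_dr, minus_dt,
      minus_exp, minus_piecewise, exp_two_mul_interiorμ hΛ ht hr, exp_interiorμ hΛ ht hr,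
      (hasDerivAt_interiorμ_radius hΛ ht hr.ne').deriv,
      (hasDerivAt_interiorμ_time hΛ ht hr.ne').deriv]
    field_simp
    ring
  · simp [dustCollapse, layer_add, layer_sub, layer_mul, layer_smooth, layer_zero_dr,
      layer_zero_dt, layer_exp, layer_piecewise, plus_piecewise, minus_piecewise,
      exteriorμ_starRadius hΛ hR₀]
  · simp [dustCollapse, layer_add, layer_sub, layer_mul, layer_smooth, layer_succ_dr,
      layer_succ_dt, layer_exp, layer_piecewise]
  · refine (hasDerivAt_const _ (0 : ℝ)).congr_of_eventuallyEq (Filter.Eventually.of_forall ?_)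
    intro r
    simp [dustCollapse, layer_add, layer_sub, layer_mul, layer_smooth, layer_succ_dr,
      layer_succ_dt, layer_exp, layer_piecewise]
  · simp [dustCollapse, layer_add, layer_sub, layer_mul, layer_smooth, layer_succ_dr,
      layer_succ_dt, layer_exp, layer_piecewise]

theorem dynamicalΘΘ_vanishes (hΛ : 0 < c.Λ) (hlam : c.lam = 1) (hΛg : c.Λg = 0) (hR₀ : 0 < R₀) :
    (dynamicalΘΘ c (starRadius c.Λ t₀ R₀) (dustCollapse c.G c.Λ t₀ R₀ A₀ ρ₀)).Vanishes
      (Set.Iio t₀) (starRadius c.Λ t₀ R₀) := by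
  rw [dynamicalΘΘ_dustCollapse c t₀ R₀ A₀ ρ₀ _ hlam hΛg]
  -- The coefficient of `δ'` is needed as a function of `r`, since its derivative on the sphere
  -- enters too.
  have hL1 : ∀ t r, (Layered.layer (let μ := (dustCollapse c.G c.Λ t₀ R₀ A₀ ρ₀).μ
      ((smooth fun _ r => r) * dr (dr μ) + (smooth fun _ _ => 2) * dr μ
          + (2 : ℝ) • ((smooth fun _ r => r) * dr μ ^ 2)) * exp ((smooth fun _ _ => 2) * μ)
        - (dt (starRadius c.Λ t₀ R₀) μ + (smooth fun _ r => r) * dr μ * dt (starRadius c.Λ t₀ R₀) μ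
          + (smooth fun _ r => r) * dt (starRadius c.Λ t₀ R₀) (dr μ)) * exp μ
        + smooth fun _ r => -(r⁻¹ * (c.Λ * r ^ 2))) 1 t r) =
      r * (exteriorμ c.Λ R₀ r - Real.log (-hubble c.Λ t₀ t * r)) *
        ((Real.exp (2 * exteriorμ c.Λ R₀ r) + Real.exp (2 * Real.log (-hubble c.Λ t₀ t * r))) / 2 +
          hubble c.Λ t₀ t * starRadius c.Λ t₀ R₀ t *
            ((Real.exp (exteriorμ c.Λ R₀ r) + Real.exp (Real.log (-hubble c.Λ t₀ t * r))) / 2)) := by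
    intro t r
    simp only [dustCollapse, layer_add, layer_sub, layer_mul, layer_smul, layer_pow, layer_smooth,
      layer_succ_dr, layer_succ_dt, layer_zero_dr, layer_exp, layer_piecewise,
      plus_piecewise, minus_piecewise, deriv_const, mean, plus_exp, minus_exp,
      plus_mul, minus_mul, plus_smooth, minus_smooth, deriv_starRadius]
    ring
  refine .of_layers (fun t ht r hr => ?_) (fun t ht r hr _ => ?_) (fun t ht => ?_)
    (fun t ht => ?_) (fun t ht => ?_) (fun n t r => ?_)
  · have hr' := (lt_starRadius hΛ hR₀ ht).trans hr
    have hr0 := (hR₀.trans hr').ne'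
    have hW := (exteriorW_pos hΛ hR₀ hr').ne'
    simp only [dustCollapse, plus_add, plus_sub, plus_mul, plus_smul, plus_pow, plus_smooth,
      plus_dr, plus_dt, plus_exp,
      plus_piecewise, deriv_const, exp_two_mul_exteriorμ hΛ hR₀ hr',
      (hasDerivAt_exteriorμ hΛ hR₀ hr').deriv]
    have := deriv_deriv_exteriorμ hΛ hR₀ hr'
    -- Unfolding brings the derivative of a lambda in the goal and the iterated `deriv` of the lemma
    -- to one form.
    unfold deriv at this ⊢
    rw [this]
    field_simp
    ring
  · have hH := (hubble_neg hΛ ht).ne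
    simp only [dustCollapse, minus_add, minus_sub, minus_mul, minus_smul, minus_pow, minus_smooth,
      minus_dr, minus_dt,
      minus_exp, minus_piecewise, exp_two_mul_interiorμ hΛ ht hr, exp_interiorμ hΛ ht hr,
      (hasDerivAt_interiorμ_radius hΛ ht hr.ne').deriv,
      (hasDerivAt_interiorμ_time hΛ ht hr.ne').deriv,
      deriv_deriv_interiorμ_radius hΛ ht hr.ne', deriv_deriv_interiorμ_time hΛ ht hr.ne']
    field_simp
    ring
  -- Continuity of `μ` along the sphere means `[∂ₜμ] = -R' [∂ᵣμ]`, so the `δ` coefficient is `2 R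
  -- [∂ᵣμ] e^μ (e^μ + R')`, which is zero. Here both jumps are inserted explicitly.
  · have hR := starRadius_pos hR₀ c.Λ t₀ t
    have hlt := lt_starRadius hΛ hR₀ ht
    have hH := (hubble_neg hΛ ht).ne
    have hd := ((hasDerivAt_exteriorμ hΛ hR₀ hlt).sub
      (hasDerivAt_interiorμ_radius hΛ ht hR.ne')).deriv
    have hdt := ((hasDerivAt_const t (exteriorμ c.Λ R₀ (starRadius c.Λ t₀ R₀ t))).sub
      (hasDerivAt_interiorμ_time hΛ ht hR.ne')).deriv
    have hJ := exteriorμ_starRadius hΛ hR₀ t₀ t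
    simp only [Pi.sub_def] at hd hdt
    simp only [dustCollapse, layer_add, layer_sub, layer_mul, layer_smul, layer_pow, layer_smooth,
      layer_zero_dr, layer_zero_dt, layer_exp, layer_piecewise,
      plus_piecewise, minus_piecewise, plus_dr, minus_dr, deriv_const, mean, plus_exp,
      minus_exp, plus_mul, minus_mul, plus_smooth, minus_smooth, deriv_starRadius, zero_add,
      zero_sub, zero_mul, mul_zero, add_zero, hd, hdt,
      (hasDerivAt_exteriorμ hΛ hR₀ hlt).deriv, (hasDerivAt_interiorμ_radius hΛ ht hR.ne').deriv]
    simp only [hJ, exp_two_mul_interiorμ hΛ ht hR, exp_interiorμ hΛ ht hR,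
      exteriorW_starRadius hΛ hR₀]
    field_simp
    ring
  · rw [hL1, exteriorμ_starRadius hΛ hR₀]
    ring
  · have hR := starRadius_pos hR₀ c.Λ t₀ t
    have hlt := lt_starRadius hΛ hR₀ ht
    have hJ := exteriorμ_starRadius hΛ hR₀ t₀ t
    have hp := hasDerivAt_exteriorμ hΛ hR₀ hlt
    have hm := hasDerivAt_interiorμ_radius hΛ ht hR.ne'
    -- Both the jump of `μ` and the mean of `e^(2μ)` plus `R'` times the mean of `e^μ` vanish on the
    -- sphere: a double zero.
    have h := ((hasDerivAt_id _).mul (hp.sub hm)).mul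
      ((((hp.const_mul 2).exp.add (hm.const_mul 2).exp).div_const 2).add
        (((hp.exp.add hm.exp).div_const 2).const_mul (hubble c.Λ t₀ t * starRadius c.Λ t₀ R₀ t)))
    refine (h.congr_deriv ?_).congr_of_eventuallyEq (Filter.Eventually.of_forall (hL1 t))
    simp only [Pi.mul_apply, Pi.sub_apply, Pi.add_apply, hJ, exp_two_mul_interiorμ hΛ ht hR,
      exp_interiorμ hΛ ht hR]
    ring
  · cases n <;> simp [dustCollapse, layer_add, layer_sub, layer_mul, layer_smul, layer_pow,
      layer_smooth, layer_succ_dr, layer_succ_dt, layer_exp, layer_piecewise]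

/-- The total is the time derivative of `R² σ + ρ₀ R³ / 3`, with `σ` the shell density: the moving
edge of the ball gives `R² R' ρ₀`, and the `δ'` from differentiating the moving shell gives `2 R R'
σ`. -/
theorem energy_integralVanishes (hG : 0 < c.G) (hR₀ : 0 < R₀) :
    (energyIntegrand (starRadius c.Λ t₀ R₀) (dustCollapse c.G c.Λ t₀ R₀ A₀ ρ₀)).IntegralVanishes
      (Set.Iio t₀) (starRadius c.Λ t₀ R₀) := by
  rw [energyIntegrand_dustCollapse]
  refine ⟨2, fun n hn t _ r => ?_, fun t ht => ⟨?_, ?_, ?_⟩⟩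
  · obtain ⟨k, rfl⟩ := Nat.exists_eq_add_of_le' hn
    simp [dustCollapse, layer_mul, layer_succ_dt, layer_smooth]
  · simp [dustCollapse, minus_mul, minus_dt]
  · simp [dustCollapse, plus_mul, plus_dt]
  · have hR := starRadius_pos hR₀ c.Λ t₀ t
    have hpi := Real.pi_pos
    simp only [dustCollapse, minus_mul, minus_dt, plus_mul, plus_dt, deriv_const, mul_zero,
      MeasureTheory.integral_zero, Finset.sum_range_succ, Finset.sum_range_zero, layer_mul,
      layer_zero_dt, layer_succ_dt, layer_smooth, mean_smooth, zero_mul, add_zero, zero_add,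
      pow_zero, pow_one, iteratedDeriv_zero, iteratedDeriv_one, if_true, one_mul,
      (hasDerivAt_shellDensity hG hR₀ c.Λ t₀ ρ₀ t).deriv, deriv_starRadius, zero_sub,
      if_false, one_ne_zero]
    rw [deriv_mul_const (by fun_prop), deriv_pow_field, shellDensity_eq hG hR₀]
    field_simp
    ring

/-- Outside, the integrand is `2 Λ r² - 2 (r W)' = 0`. Inside it is a constant times `r²`, and the
shell term cancels its integral. -/
theorem hamiltonian_integralVanishes (hG : 0 < c.G) (hΛ : 0 < c.Λ) (hlam : c.lam = 1)
    (hR₀ : 0 < R₀) :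
    (hamiltonianIntegrand c (starRadius c.Λ t₀ R₀)
      (dustCollapse c.G c.Λ t₀ R₀ A₀ ρ₀)).IntegralVanishes
      (Set.Iio t₀) (starRadius c.Λ t₀ R₀) := by
  rw [hamiltonianIntegrand_dustCollapse c t₀ R₀ A₀ ρ₀ _ hlam]
  refine ⟨1, fun n hn t _ r => ?_, fun t ht => ?_⟩
  · obtain ⟨k, rfl⟩ := Nat.exists_eq_add_of_le' hn
    simp [dustCollapse, layer_mul, layer_add, layer_sub, layer_smul, layer_succ_dr, layer_smooth,
      layer_exp, layer_piecewise]
  have hR := starRadius_pos hR₀ c.Λ t₀ t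
  set μ := (dustCollapse c.G c.Λ t₀ R₀ A₀ ρ₀).μ with hμ
  set F := ((smooth fun _ _ => 2 * c.Λ)
        - (smooth fun _ r => 2 * r⁻¹ ^ 2) * exp ((smooth fun _ _ => 2) * μ)
          * ((smooth fun _ r => 2 * r) * dr μ + smooth fun _ _ => 1)
        + (4 * Real.pi * c.G) • (dustCollapse c.G c.Λ t₀ R₀ A₀ ρ₀).ρH)
        * smooth fun _ r => r ^ 2 with hF
  have hminus : Set.EqOn (F.minus t)
      (fun r => (2 * c.Λ - 6 * hubble c.Λ t₀ t ^ 2 + 4 * Real.pi * c.G * ρ₀) * r ^ 2)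
      (Set.Ioo 0 (starRadius c.Λ t₀ R₀ t)) := by
    intro r hr
    have hr0 := hr.1
    simp only [hF, hμ, dustCollapse, minus_add, minus_sub, minus_mul, minus_smul, minus_smooth,
      minus_dr, minus_exp, minus_piecewise, exp_two_mul_interiorμ hΛ ht hr0,
      (hasDerivAt_interiorμ_radius hΛ ht hr0.ne').deriv]
    field_simp
    ring
  have hplus : Set.EqOn (F.plus t) (fun _ => 0) (Set.Ioi (starRadius c.Λ t₀ R₀ t)) := by
    intro r hr
    have hr' := (lt_starRadius hΛ hR₀ ht).trans hr
    have hr0 := (hR₀.trans hr').ne'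
    have hW := (exteriorW_pos hΛ hR₀ hr').ne'
    simp only [hF, hμ, dustCollapse, plus_add, plus_sub, plus_mul, plus_smul, plus_smooth,
      plus_dr, plus_exp, plus_piecewise, exp_two_mul_exteriorμ hΛ hR₀ hr',
      (hasDerivAt_exteriorμ hΛ hR₀ hr').deriv]
    field_simp
    ring
  have hlayer : F.layer 0 t (starRadius c.Λ t₀ R₀ t) =
      4 * Real.pi * c.G * shellDensity c.G c.Λ t₀ R₀ ρ₀ t * starRadius c.Λ t₀ R₀ t ^ 2 := by
    simp [hF, hμ, dustCollapse, layer_mul, layer_add, layer_sub, layer_smul, layer_zero_dr,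
      layer_smooth, layer_exp, layer_piecewise, mean_smooth, plus_piecewise, minus_piecewise,
      exteriorμ_starRadius hΛ hR₀]
  change MeasureTheory.IntegrableOn (F.minus t) _ ∧ MeasureTheory.IntegrableOn (F.plus t) _ ∧
    (∫ r in _, F.minus t r) + (∫ r in _, F.plus t r) + _ = _
  refine ⟨?_, ?_, ?_⟩
  · rw [MeasureTheory.integrableOn_congr_fun hminus measurableSet_Ioo]
    exact (Continuous.integrableOn_Icc (by fun_prop)).mono_set Set.Ioo_subset_Icc_self
  · rw [MeasureTheory.integrableOn_congr_fun hplus measurableSet_Ioi]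
    exact MeasureTheory.integrableOn_zero
  · rw [MeasureTheory.setIntegral_congr_fun measurableSet_Ioo hminus,
      MeasureTheory.setIntegral_congr_fun measurableSet_Ioi hplus,
      ← MeasureTheory.integral_Ioc_eq_integral_Ioo, ← intervalIntegral.integral_of_le hR.le,
      intervalIntegral.integral_const_mul, integral_pow]
    have h := hubble_sq_mul_starRadius_cube hΛ t₀ R₀ t
    have hpi := Real.pi_pos
    -- Replacing `Λ R₀³` by `(Λ - 3 H²) R³` leaves an identity in `R` and `H` alone.
    simp only [MeasureTheory.integral_zero, Finset.sum_range_one, pow_zero, iteratedDeriv_zero,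
      hlayer, shellDensity_eq hG hR₀, ← h]
    field_simp
    push_cast
    ring

theorem dustCollapse_regular (hΛ : 0 < c.Λ) (hR₀ : 0 < R₀) :
    Regular (starRadius c.Λ t₀ R₀) (dustCollapse c.G c.Λ t₀ R₀ A₀ ρ₀) (Set.Iio t₀) where
  radius_pos t _ := starRadius_pos hR₀ c.Λ t₀ t
  radius_C5 := (contDiff_starRadius c.Λ t₀ R₀).contDiffOn
  noLayer_μ _ _ _ := rfl
  noLayer_ν _ _ _ := rfl
  noLayer_JA _ _ _ := rfl
  piecewise_μ := by
    -- As `R > R₀`, the open set `r > R₀` contains the exterior together with the sphere.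
    refine ⟨⟨{p | R₀ < p.2}, isOpen_lt continuous_const continuous_snd,
      fun p hp => (lt_starRadius hΛ hR₀ hp.1).trans_le hp.2, ?_⟩,
      ⟨{p | p.1 < t₀ ∧ 0 < p.2}, (isOpen_lt continuous_fst continuous_const).inter
        (isOpen_lt continuous_const continuous_snd), fun p hp => ⟨hp.1, hp.2.1⟩, ?_⟩⟩
    · change ContDiffOn ℝ 5 (fun p : ℝ × ℝ => exteriorμ c.Λ R₀ p.2) _
      refine contDiffOn_const.mul (ContDiffOn.log ?_ fun p hp => (exteriorW_pos hΛ hR₀ hp).ne')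
      refine ContDiffOn.sub (by fun_prop) (contDiffOn_const.div (by fun_prop) fun p hp => ?_)
      exact mul_ne_zero three_ne_zero (hR₀.trans hp).ne'
    · change ContDiffOn ℝ 5 (fun p : ℝ × ℝ => Real.log (-hubble c.Λ t₀ p.1 * p.2)) _
      refine ContDiffOn.log ?_ fun p hp => (neg_hubble_mul_pos hΛ hp.1 hp.2).ne'
      refine ContDiffOn.mul ?_ contDiffOn_snd
      simp only [hubble, Real.tanh_eq_sinh_div_cosh, phase]
      refine (contDiffOn_const.mul (ContDiffOn.div ?_ ?_ fun p _ => (Real.cosh_pos _).ne')).neg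
      · fun_prop
      · fun_prop
  piecewise_ν := ⟨⟨Set.univ, isOpen_univ, Set.subset_univ _, contDiffOn_const⟩,
    ⟨Set.univ, isOpen_univ, Set.subset_univ _, contDiffOn_const⟩⟩
  matches_μ j hj t _ := by
    obtain rfl := Nat.le_zero.1 hj
    exact exteriorμ_starRadius hΛ hR₀ t₀ t
  matches_ν _ _ _ _ := rfl
  matches_JA _ _ _ _ := rfl
  spacelike t ht := by
    have hR := starRadius_pos hR₀ c.Λ t₀ t
    have hν : (dustCollapse c.G c.Λ t₀ R₀ A₀ ρ₀).ν.mean t (starRadius c.Λ t₀ R₀ t) = 0 := by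
      change (0 : Layered).mean _ _ = 0
      rw [zero_eq_smooth, mean_smooth]
    rw [hν]
    -- On the sphere `e^μ + R' = -H R + H R = 0`, so the quantity equals `1`.
    simp only [dustCollapse, mean, plus_piecewise, minus_piecewise, exteriorμ_starRadius hΛ hR₀,
      add_self_div_two, exp_interiorμ hΛ ht hR, Real.exp_zero, deriv_starRadius]
    norm_num

/-- With `e^(2μ) = 1 - f` and `ψ' = e^μ / f`, the cross term is `-f ψ' + e^μ = 0` and the radial one
is `-f ψ'² + 2 e^μ ψ' + 1 = 1 / f`. -/
theorem timeShiftJacobian_conj_admMetric {M Λ r μ : ℝ} (hf : sdsFactor M Λ r ≠ 0)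
    (hμ : Real.exp (2 * μ) = 1 - sdsFactor M Λ r) (θ : ℝ) :
    (timeShiftJacobian (Real.exp μ / sdsFactor M Λ r)).transpose * admMetric μ 0 r θ *
      timeShiftJacobian (Real.exp μ / sdsFactor M Λ r) = sdsMetric M Λ r θ := by
  have he : Real.exp μ ^ 2 = 1 - sdsFactor M Λ r := by
    rw [← hμ, ← Real.exp_nat_mul]
    norm_num
  unfold sdsMetric admMetric
  rw [hμ, add_zero]
  generalize sdsFactor M Λ r = f at *
  generalize Real.exp μ = e at *
  ext i j
  fin_cases i <;> fin_cases j <;>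
    simp [timeShiftJacobian, Matrix.mul_apply, Fin.sum_univ_four] <;>
    field_simp <;> try simp only [he]
  all_goals ring

theorem isSchwarzschildDeSitter_exteriorμ {Λ : ℝ} (hΛ : 0 < Λ) (hR₀ : 0 < R₀) :
    IsSchwarzschildDeSitter (-Λ * R₀ ^ 3 / 6) Λ R₀ (exteriorμ Λ R₀) (fun _ => 0) := by
  intro a b ha hf
  let q : ℝ → ℝ := fun r => Real.exp (exteriorμ Λ R₀ r) / sdsFactor (-Λ * R₀ ^ 3 / 6) Λ r
  have hq : ContinuousOn q (Set.Ioo a b) := by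
    intro r hr
    have hr' := ha.trans_lt hr.1
    have hr0 := (hR₀.trans hr').ne'
    refine ContinuousAt.continuousWithinAt (ContinuousAt.div
      (hasDerivAt_exteriorμ hΛ hR₀ hr').continuousAt.rexp ?_ (hf r hr))
    unfold sdsFactor
    fun_prop (disch := exact hr0)
  -- `ψ` is a primitive of `e^μ / f`; the midpoint is a base point inside the interval whenever it
  -- is nonempty, so no horizon is crossed.
  refine ⟨fun r => ∫ x in ((a + b) / 2)..r, q x, fun r hr => ?_⟩
  have hr' := ha.trans_lt hr.1
  have hr0 := (hR₀.trans hr').ne'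
  have hab := hr.1.trans hr.2
  have hmid : (a + b) / 2 ∈ Set.Ioo a b := ⟨by linarith, by linarith⟩
  have hd : HasDerivAt (fun r => ∫ x in ((a + b) / 2)..r, q x) (q r) r := by
    refine intervalIntegral.integral_hasDerivAt_right ?_ ?_
      (hq.continuousAt (Ioo_mem_nhds hr.1 hr.2))
    · exact (hq.mono (Set.ordConnected_Ioo.uIcc_subset hmid hr)).intervalIntegrable
    · exact hq.stronglyMeasurableAtFilter isOpen_Ioo r hr
  refine ⟨hd.differentiableAt, fun θ => ?_⟩
  rw [hd.deriv]
  refine timeShiftJacobian_conj_admMetric (hf r hr) ?_ θ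
  rw [exp_two_mul_exteriorμ hΛ hR₀ hr', exteriorW, sdsFactor]
  field_simp
  ring

end Solution
end HoravaLifshitz

theorem mainTheorem2 (c : HoravaLifshitz.Couplings)
    (hG : 0 < c.G) (hΛ : 0 < c.Λ) (hlam : c.lam = 1) (hΛg : c.Λg = 0)
    (t₀ R₀ A₀ ρ₀ : ℝ) (hR₀ : 0 < R₀) :
    HoravaLifshitz.IsSolution c (HoravaLifshitz.starRadius c.Λ t₀ R₀)
      (HoravaLifshitz.dustCollapse c.G c.Λ t₀ R₀ A₀ ρ₀) (Set.Iio t₀) ∧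
    (∀ t ∈ Set.Iio t₀, HasDerivAt (HoravaLifshitz.starRadius c.Λ t₀ R₀)
      (HoravaLifshitz.hubble c.Λ t₀ t * HoravaLifshitz.starRadius c.Λ t₀ R₀ t) t) ∧
    StrictAntiOn (HoravaLifshitz.starRadius c.Λ t₀ R₀) (Set.Iio t₀) ∧
    (∀ t ∈ Set.Iio t₀, HoravaLifshitz.hubble c.Λ t₀ t < 0) ∧
    (∀ r, R₀ < r → 0 < c.Λ * r ^ 2 / 3 - R₀ ^ 3 * c.Λ / (3 * r)) ∧
    (∀ t ∈ Set.Iio t₀, R₀ < HoravaLifshitz.starRadius c.Λ t₀ R₀ t) ∧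
    (-c.Λ * R₀ ^ 3 / 6 < 0 ∧
      HoravaLifshitz.IsSchwarzschildDeSitter (-c.Λ * R₀ ^ 3 / 6) c.Λ R₀
        (HoravaLifshitz.exteriorμ c.Λ R₀) (fun _ => 0)) := by
  open HoravaLifshitz in
  refine ⟨⟨dustCollapse_regular A₀ ρ₀ hΛ hR₀, hamiltonian_integralVanishes A₀ ρ₀ hG hΛ hlam hR₀,
    ?_, ?_, ?_, dynamicalRR_vanishes A₀ ρ₀ hΛ hlam hΛg hR₀,
    dynamicalΘΘ_vanishes A₀ ρ₀ hΛ hlam hΛg hR₀, energy_integralVanishes A₀ ρ₀ hG hR₀, ?_⟩,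
    fun t _ => hasDerivAt_starRadius c.Λ t₀ R₀ t, strictAntiOn_starRadius hΛ hR₀ t₀,
    fun t ht => hubble_neg hΛ ht, fun r hr => exteriorW_pos hΛ hR₀ hr,
    fun t ht => lt_starRadius hΛ hR₀ ht, ?_, isSchwarzschildDeSitter_exteriorμ hΛ hR₀⟩
  · rw [momentumConstraint_dustCollapse c t₀ R₀ A₀ ρ₀ _ hlam]
    exact Layered.vanishes_smooth_zero _ _
  · rw [prepotentialEquation_dustCollapse c t₀ R₀ A₀ ρ₀ _ hlam hΛg]
    exact Layered.vanishes_smooth_zero _ _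
  · rw [gaugeEquation_dustCollapse c t₀ R₀ A₀ ρ₀ hΛg]
    exact Layered.vanishes_smooth_zero _ _
  · rw [momentumConservation_dustCollapse c t₀ R₀ A₀ ρ₀]
    exact Layered.vanishes_smooth_zero _ _
  · have : 0 < c.Λ * R₀ ^ 3 := by positivity
    linarith
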